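/- Let $d\ge 1$, let $\langle\cdot,\cdot\rangle$ and $\|\cdot\|$ be the Euclidean inner product and norm on $\mathbb{R}^d$, and let $\mathcal{S}(\mathbb{R}^d)$ be the space of real-valued Schwartz functions. Let $X$ be a random vector in $\mathbb{R}^d$ with law $\mu_X$ and characteristic function $\varphi(\xi)=\mathbb{E}\,e^{i\langle \xi,X\rangle}$, such that: (1) $X$ is non-degenerate: the support of $\mu_X$ is not contained in any $(d-1)$-dimensional linear subspace of $\mathbb{R}^d$; (2) $X$ is self-decomposable: for every $\gamma\in(0,1)$ there is a probability measure $\rho_\gamma$ on $\mathbb{R}^d$ with $\varphi(\xi)=\varphi(\gamma\xi)\int e^{i\langle\xi,u\rangle}\rho_\gamma(du)$ for all $\xi\in\mathbb{R}^d$; (3) $X$ has no Gaussian component and Lévy measure $\nu$: $\nu$ is a Borel measure on $\mathbb{R}^d$ with $\nu(\{0\})=0$ and $\int (1\wedge\|u\|^2)\,\nu(du)<\infty$, and for some $b\in\mathbb{R}^d$ and all $\xi$, $$\varphi(\xi)=\exp\Big(i\langle b,\xi\rangle+\int_{\mathbb{R}^d}\big(e^{i\langle\xi,u\rangle}-1-i\langle\xi,u\rangle\mathbf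 1_{\|u\|\le1}\big)\nu(du)\Big);$$ (4) $\mathbb{E}\|X\|<\infty$; (5) in the polar decomposition $$\nu(B)=\int_{S^{d-1}}\lambda(dx)\int_0^\infty \mathbf 1_B(rx)\,k_x(r)\,\frac{dr}{r},\qquad B\subset\mathbb{R}^d\setminus\{0\}\ \text{Borel},$$ where $\lambda$ is a probability measure on the unit sphere $S^{d-1}$, $k_x(r)\ge 0$ is measurable in $x$, non-increasing and right-continuous in $r>0$, and $\int_0^\infty (r^2\wedge 1)k_x(r)\frac{dr}{r}$ is finite and independent of $x$, one has $\sup_{x\in S^{d-1}}\sup_{r\in(a,b)}k_x(r)<\infty$ for all $0<a<b<\infty$, the supremum over $x$ being the $\lambda$-essential supremum. For $f\in\mathcal{S}(\mathbb{R}^d)$, $t\ge0$ and $x\in\mathbb{R}^d$ put $$P^\nu_t f(x)=\frac1{(2\pi)^d}\int_{\mathbb{R}^d}\mathcal F(f)(\xi)\,e^{ie^{-t}\langle x,\xi\rangle}\frac{\varphi(\xi)}{\varphi(e^{-t}\xi)}\,d\xi,\qquad \mathcal F(f)(\xi)=\int_{\mathbb{R}^d} f(x)e^{-i\langle\xi,x\rangle}dx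 .$$ Then: (a) For each $t\ge0$ there is a probability measure $\mu_t$ on $\mathbb{R}^d$ with characteristic function $\xi\mapsto\varphi(\xi)/\varphi(e^{-t}\xi)$, and $P^\nu_t f(x)=\int f(u+e^{-t}x)\,\mu_t(du)$ for all $f\in\mathcal{S}(\mathbb{R}^d)$ and $x\in\mathbb{R}^d$. (b) The operators $P^\nu_t$ extend to bounded operators on $L^1(\mu_X)$ by the same formula: for $f\in L^1(\mu_X)$ and $\mu_X$-almost every $x$, the function $u\mapsto f(u+e^{-t}x)$ is $\mu_t$-integrable and $P^\nu_tf(x)=\int f(u+e^{-t}x)\,\mu_t(du)$. The family $(P^\nu_t)_{t\ge0}$ is a $C_0$-semigroup on $L^1(\mu_X)$, and $\mu_X$ is invariant: $\int P^\nu_tf\,d\mu_X=\int f\,d\mu_X$ for all $f\in L^1(\mu_X)$ and $t\ge0$. (c) Every $f\in\mathcal{S}(\mathbb{R}^d)$ belongs to the domain of the generator $\mathcal A$ of this semigroup, and $$\mathcal{A}f(x)=\langle \mathbb{E}X-x,\nabla f(x)\rangle+\int_{\mathbb{R}^d}\langle\nabla f(x+u)-\nabla f(x),u\rangle\,\nu(du),$$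 where the integral converges absolutely for every $x\in\mathbb{R}^d$, and the function on the right is in $L^1(\mu_X)$. Moreover $\lim_{t\to0^+}\frac1t\big(P^\nu_tf(x)-f(x)\big)$ exists and equals the right-hand side for every $x\in\mathbb{R}^d$. -/

import Mathlib

open MeasureTheory ProbabilityTheory Filter Topology Set
open scoped NNReal ENNReal SchwartzMap

noncomputable section

namespace SelfDecomp

/-- The Euclidean space `ℝ^d`. -/
abbrev Euc (d : ℕ) : Type := EuclideanSpace ℝ (Fin d)

/-- The Euclidean unit sphere of `ℝ^d`. -/
abbrev Sph (d : ℕ) : Type := Metric.sphere (0 : Euc d) 1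

/-- The support of the law `μ` is contained in no `(d-1)`-dimensional linear subspace. -/
def IsNonDegenerate {d : ℕ} (μ : Measure (Euc d)) : Prop :=
  ∀ V : Submodule ℝ (Euc d), Module.finrank ℝ V + 1 = d → ¬ (μ.support ⊆ (V : Set (Euc d)))

/-- Self-decomposability: for every `γ ∈ (0,1)` there is a probability measure `μ_γ` whose
characteristic function is `ξ ↦ φ(ξ) / φ(γ ξ)`. -/
def IsSelfDecomposable {d : ℕ} (μ : Measure (Euc d)) : Prop :=
  ∀ γ : ℝ, 0 < γ → γ < 1 → ∃ ρ : Measure (Euc d), IsProbabilityMeasure ρ ∧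
    ∀ ξ : Euc d, charFun μ ξ = charFun μ (γ • ξ) * charFun ρ ξ

/-- Lévy measures: `ν({0}) = 0` and `∫ (1 ∧ ‖u‖²) ν(du) < ∞`. -/
structure IsLevyMeasure {d : ℕ} (ν : Measure (Euc d)) : Prop where
  zero : ν {0} = 0
  lintegral_lt_top : ∫⁻ u, ENNReal.ofReal (min 1 (‖u‖ ^ 2)) ∂ν < ⊤

/-- The law `μ` is infinitely divisible with triplet `(b, A, ν)`, the truncation being on the
closed unit ball. -/
structure IsInfDivTriplet {d : ℕ} (μ : Measure (Euc d)) (b : Euc d)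
    (A : Matrix (Fin d) (Fin d) ℝ) (ν : Measure (Euc d)) : Prop where
  posSemidef : A.PosSemidef
  levy : IsLevyMeasure ν
  charFun_eq : ∀ ξ : Euc d, charFun μ ξ =
    Complex.exp (Complex.I * (inner ℝ b ξ : ℝ)
      - (1 / 2 : ℂ) * (inner ℝ ξ (Matrix.toEuclideanLin A ξ) : ℝ)
      + ∫ u, (Complex.exp (Complex.I * (inner ℝ ξ u : ℝ)) - 1
          - Complex.I * ((Metric.closedBall (0 : Euc d) 1).indicator
              (fun v => (inner ℝ ξ v : ℝ)) u : ℝ)) ∂ν)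

/-- `(lam, k)` is a normalized polar decomposition
`ν(B) = ∫ lam(dx) ∫_0^∞ 1_B(r x) k_x(r) dr / r`, for Borel sets `B` avoiding the origin. -/
structure IsPolarDecomposition {d : ℕ} (ν : Measure (Euc d)) (lam : Measure (Sph d))
    (k : Sph d → ℝ → ℝ) : Prop where
  prob : IsProbabilityMeasure lam
  nonneg : ∀ x, ∀ r, 0 < r → 0 ≤ k x r
  measurable : ∀ r, 0 < r → Measurable fun x => k x r
  antitone : ∀ x, AntitoneOn (k x) (Ioi 0)
  rightCts : ∀ x, ∀ r, 0 < r → ContinuousWithinAt (k x) (Ici r) r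
  normalized : ∃ c : ℝ≥0, ∀ x,
    ∫⁻ r in Ioi (0 : ℝ), ENNReal.ofReal (min (r ^ 2) 1 * k x r / r) = c
  polar : ∀ B : Set (Euc d), MeasurableSet B → (0 : Euc d) ∉ B →
    ν B = ∫⁻ x : Sph d, (∫⁻ r in Ioi (0 : ℝ),
      B.indicator (fun _ => ENNReal.ofReal (k x r / r)) (r • (x : Euc d))) ∂lam

/-- The functions `k_x` of the polar decomposition of `ν` satisfy
`sup_x sup_{r ∈ (a,b)} k_x(r) < ∞` for all `0 < a < b < ∞`, where the supremum over `x` is the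
`lam`-essential supremum. -/
def LocallyBoundedRadial {d : ℕ} (ν : Measure (Euc d)) : Prop :=
  ∀ (lam : Measure (Sph d)) (k : Sph d → ℝ → ℝ), IsPolarDecomposition ν lam k →
    ∀ a b : ℝ, 0 < a → a < b → ∃ C : ℝ, ∀ᵐ x ∂lam, ∀ r ∈ Ioo a b, k x r ≤ C

/-- The Fourier transform `F(f)(ξ) = ∫ f(x) exp(-i⟨ξ, x⟩) dx`. -/
def fourierS {d : ℕ} (f : 𝓢(Euc d, ℝ)) (ξ : Euc d) : ℂ :=
  ∫ x, (f x : ℂ) * Complex.exp (-(Complex.I * (inner ℝ ξ x : ℝ)))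

/-- `P_t(f)(x) = (2π)^{-d} ∫ F(f)(ξ) exp(i e^{-t} ⟨x, ξ⟩) φ(ξ) / φ(e^{-t} ξ) dξ`, with `φ` the
characteristic function of `μ`. -/
def semigroupS {d : ℕ} (μ : Measure (Euc d)) (t : ℝ≥0) (f : 𝓢(Euc d, ℝ)) (x : Euc d) : ℂ :=
  (1 / (2 * Real.pi : ℂ) ^ d) *
    ∫ ξ, fourierS f ξ * Complex.exp (Complex.I * (Real.exp (-(t : ℝ)) * inner ℝ x ξ : ℝ))
      * (charFun μ ξ / charFun μ (Real.exp (-(t : ℝ)) • ξ))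

/-- `⟨m - x, ∇f(x)⟩ + ∫ ⟨∇f(x+u) - ∇f(x), u⟩ ν(du)`. -/
def steinOp {d : ℕ} (m : Euc d) (ν : Measure (Euc d)) (f : 𝓢(Euc d, ℝ)) (x : Euc d) : ℝ :=
  inner ℝ (m - x) (gradient f x) + ∫ u, inner ℝ (gradient f (x + u) - gradient f x) u ∂ν

/-- `C_0`-semigroups of bounded operators on a normed space. -/
structure IsC0Semigroup {Y : Type*} [NormedAddCommGroup Y] [NormedSpace ℝ Y]
    (T : ℝ≥0 → Y →L[ℝ] Y) : Prop where
  map_zero : T 0 = ContinuousLinearMap.id ℝ Y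
  map_add : ∀ s t, T (s + t) = (T s).comp (T t)
  strongly_continuous : ∀ y, Tendsto (fun t => T t y) (𝓝[>] 0) (𝓝 y)

/-- `y` is in the domain of the (infinitesimal) generator of `T`, whose value at `y` is `z`. -/
def HasGenerator {Y : Type*} [NormedAddCommGroup Y] [NormedSpace ℝ Y]
    (T : ℝ≥0 → Y →L[ℝ] Y) (y z : Y) : Prop :=
  Tendsto (fun t : ℝ≥0 => (t : ℝ)⁻¹ • (T t y - y)) (𝓝[>] 0) (𝓝 z)

end SelfDecomp

end

/-! Everything rests on two descriptions of `P_t`: as an average against `μ_t`, and as a Fourier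
multiplier.

The average. Since `φ` is an exponential it never vanishes, so self-decomposability with `γ =
e^{-t}` gives `μ_t`. If `X ~ μ` and `Y ~ μ_t` are independent, then `Y + e^{-t} X ~ μ`, because
characteristic functions determine laws (`measurePreserving_add_smul`). Hence averaging is well
defined on `L¹(μ)`, is a contraction and leaves `μ` invariant. The semigroup law is the same
argument applied to `μ_s` and `μ_t`.

The multiplier. A first moment of `μ` forces `min ‖u‖ ‖u‖²` to be `ν`-integrable
(`IsInfDivTriplet.integrable_min_norm_sq`), so that `φ = exp ψ` with the compensator untruncated and
the mean as drift (`IsInfDivTriplet.charFun_eq_exp_levyExp`). The multiplier `exp(i e^{-t}⟨x, ξ⟩ +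
ψ(ξ) - ψ(e^{-t}ξ))` is then differentiable in `t`. At `t = 0` its derivative is the symbol of
`steinOp` (`steinOp_eq_integral_fourierS`). It has modulus at most `1`, since its second factor is
the characteristic function of `μ_t`. So its difference quotients are bounded by a quadratic
polynomial in `‖ξ‖` plus `‖x‖ ‖ξ‖`, uniformly in `t`.

Dominated convergence in `ξ` gives the pointwise generator; dominated convergence in `x`, with an
affine bound in `‖x‖`, gives it in `L¹(μ)`. Strong continuity follows from the generator on the
dense Schwartz space and contractivity. -/

namespace SelfDecomp

/-! ### First moments: from the law to its Lévy measure. -/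

section

theorem norm_exp_I_mul_sub_one_sub_le (x : ℝ) :
    ‖Complex.exp (Complex.I * x) - 1 - Complex.I * x‖ ≤ 2 * x ^ 2 := by
  have hn : ‖Complex.I * (x : ℂ)‖ = |x| := by simp
  rcases le_total |x| 1 with h | h
  · have := Complex.norm_exp_sub_one_sub_id_le (x := Complex.I * x) (by rwa [hn])
    rw [hn, sq_abs] at this
    nlinarith [sq_nonneg x]
  · have h1 : ‖Complex.exp (Complex.I * x) - 1‖ ≤ |x| := Real.norm_exp_I_mul_ofReal_sub_one_le
    have h2 := norm_sub_le (Complex.exp (Complex.I * x) - 1) (Complex.I * x)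
    rw [hn] at h2
    nlinarith [sq_abs x]

/-- Up to a constant this integral is `|y|`, which is how a first moment is read off from `1 - cos`.
The range is split at `s = 1/|y|`: a quadratic bound on `1 - cos` below contributes `|y|`, and the
trivial bound `2` above contributes `2|y|`. -/
theorem lintegral_one_sub_cos_div_sq_le (y : ℝ) :
    ∫⁻ s in Ioi (0 : ℝ), ENNReal.ofReal ((1 - Real.cos (s * y)) / s ^ 2)
      ≤ ENNReal.ofReal (3 * |y|) := by
  rcases eq_or_ne y 0 with rfl | hy
  · simp
  have hy' : 0 < |y| := abs_pos.2 hy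
  have ha : 0 < |y|⁻¹ := inv_pos.2 hy'
  have h1 : ∫⁻ s in Ioc 0 |y|⁻¹, ENNReal.ofReal ((1 - Real.cos (s * y)) / s ^ 2)
      ≤ ENNReal.ofReal |y| := by
    calc _ ≤ ∫⁻ _s in Ioc 0 |y|⁻¹, ENNReal.ofReal (y ^ 2) := by
          refine setLIntegral_mono (by fun_prop) fun s hs => ENNReal.ofReal_le_ofReal ?_
          have := Real.one_sub_sq_div_two_le_cos (x := s * y)
          rw [div_le_iff₀ (pow_pos hs.1 2)]
          nlinarith [sq_nonneg (s * y)]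
      _ = ENNReal.ofReal |y| := by
          rw [setLIntegral_const, Real.volume_Ioc, ← ENNReal.ofReal_mul (sq_nonneg y)]
          congr 1
          rw [← sq_abs]; field_simp; ring
  have h2 : ∫⁻ s in Ioi |y|⁻¹, ENNReal.ofReal ((1 - Real.cos (s * y)) / s ^ 2)
      ≤ ENNReal.ofReal (2 * |y|) := by
    calc _ ≤ ∫⁻ s in Ioi |y|⁻¹, ENNReal.ofReal (2 * s ^ (-2 : ℝ)) := by
          refine setLIntegral_mono (by fun_prop) fun s hs => ENNReal.ofReal_le_ofReal ?_
          have hs0 : 0 < s := ha.trans hs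
          rw [Real.rpow_neg hs0.le, Real.rpow_ofNat, ← div_eq_mul_inv]
          gcongr
          linarith [Real.neg_one_le_cos (s * y)]
      _ = ENNReal.ofReal (2 * |y|) := by
          rw [← ofReal_integral_eq_lintegral_ofReal
            ((integrableOn_Ioi_rpow_of_lt (by norm_num) ha).const_mul 2)
            ((ae_restrict_iff' measurableSet_Ioi).2 (ae_of_all _ fun s hs => by
              have hs0 : 0 < s := ha.trans hs
              positivity)),
            integral_const_mul, integral_Ioi_rpow_of_lt (by norm_num) ha]
          congr 1
          norm_num
          rw [Real.rpow_neg_one, inv_inv]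
  rw [← Ioc_union_Ioi_eq_Ioi ha.le]
  calc _ ≤ _ := lintegral_union_le _ _ _
    _ ≤ ENNReal.ofReal |y| + ENNReal.ofReal (2 * |y|) := add_le_add h1 h2
    _ = ENNReal.ofReal (3 * |y|) := by
        rw [← ENNReal.ofReal_add (by positivity) (by positivity)]; congr 1; ring

/-- The hypothesis puts `(0, 1/|y|)` inside `(0, δ)`, and there `1 - cos(sy) ≥ (sy)²/8`. -/
theorem le_lintegral_one_sub_cos_div_sq {y δ : ℝ} (hδ : 0 < δ) (h : 1 ≤ δ * |y|) :
    ENNReal.ofReal (|y| / 8)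
      ≤ ∫⁻ s in Ioo (0 : ℝ) δ, ENNReal.ofReal ((1 - Real.cos (s * y)) / s ^ 2) := by
  have hy' : 0 < |y| := by
    by_contra! hy
    nlinarith
  have ha : 0 < |y|⁻¹ := inv_pos.2 hy'
  have haδ : |y|⁻¹ ≤ δ := by rwa [inv_le_iff_one_le_mul₀ hy']
  calc ENNReal.ofReal (|y| / 8)
      = ∫⁻ _s in Ioo 0 |y|⁻¹, ENNReal.ofReal (y ^ 2 / 8) := by
        rw [setLIntegral_const, Real.volume_Ioo, ← ENNReal.ofReal_mul (by positivity)]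
        congr 1
        rw [← sq_abs]; field_simp; ring
    _ ≤ ∫⁻ s in Ioo 0 |y|⁻¹, ENNReal.ofReal ((1 - Real.cos (s * y)) / s ^ 2) := by
        refine setLIntegral_mono (by fun_prop) fun s hs => ENNReal.ofReal_le_ofReal ?_
        have hsy : |s * y| ≤ 1 := by
          rw [abs_mul, abs_of_pos hs.1]
          have := mul_le_mul_of_nonneg_right hs.2.le hy'.le
          rwa [inv_mul_cancel₀ hy'.ne'] at this
        have h1 := (abs_le.1 (Real.cos_bound hsy)).2
        have h2 : |s * y| ^ 4 ≤ (s * y) ^ 2 := by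
          rw [← sq_abs (s * y)]
          exact pow_le_pow_of_le_one (abs_nonneg _) hsy (by norm_num)
        rw [le_div_iff₀ (pow_pos hs.1 2)]
        nlinarith
    _ ≤ _ := lintegral_mono_set (Ioo_subset_Ioo_right haδ)

variable {d : ℕ} {ν : Measure (Euc d)}

/-- Needed for Fubini. Weighting `ν` by `min 1 ‖u‖²` gives a finite measure, and the weight can be
inverted because `ν` does not charge the origin. -/
theorem IsLevyMeasure.sFinite (h : IsLevyMeasure ν) : SFinite ν := by
  set g : Euc d → ℝ≥0∞ := fun u => ENNReal.ofReal (min 1 (‖u‖ ^ 2)) with hg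
  have hgm : Measurable g := by fun_prop
  have hfin : IsFiniteMeasure (ν.withDensity g) :=
    isFiniteMeasure_withDensity h.lintegral_lt_top.ne
  have h0 : ∀ᵐ u ∂ν, g u ≠ 0 := by
    have : ∀ᵐ u ∂ν, u ≠ 0 := by
      rw [ae_iff]; simpa using h.zero
    filter_upwards [this] with u hu
    have : 0 < ‖u‖ := norm_pos_iff.2 hu
    simp only [hg, ne_eq, ENNReal.ofReal_eq_zero, not_le]
    positivity
  rw [← withDensity_inv_same hgm h0 (by simp [hg])]
  infer_instance

theorem IsLevyMeasure.integrable_min_one_sq (h : IsLevyMeasure ν) :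
    Integrable (fun u => min 1 (‖u‖ ^ 2)) ν := by
  refine ⟨by fun_prop, ?_⟩
  rw [hasFiniteIntegral_iff_ofReal (ae_of_all _ fun u => by positivity)]
  exact h.lintegral_lt_top

/-- The integrand of the Lévy–Khintchine formula. -/
noncomputable def levyIntegrand (ξ u : Euc d) : ℂ :=
  Complex.exp (Complex.I * (inner ℝ ξ u : ℝ)) - 1
    - Complex.I * ((Metric.closedBall (0 : Euc d) 1).indicator (fun v => (inner ℝ ξ v : ℝ)) u : ℝ)

theorem norm_levyIntegrand_le (ξ u : Euc d) :
    ‖levyIntegrand ξ u‖ ≤ 2 * (1 + ‖ξ‖ ^ 2) * min 1 (‖u‖ ^ 2) := by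
  have hin : (inner ℝ ξ u : ℝ) ^ 2 ≤ (‖ξ‖ * ‖u‖) ^ 2 := by
    rw [← sq_abs]; gcongr; exact abs_real_inner_le_norm ξ u
  by_cases hu : ‖u‖ ≤ 1
  · rw [levyIntegrand, indicator_of_mem (by simpa using hu), min_eq_right (by nlinarith [norm_nonneg u])]
    refine (norm_exp_I_mul_sub_one_sub_le _).trans ?_
    nlinarith [sq_nonneg ‖u‖]
  · push Not at hu
    rw [levyIntegrand, indicator_of_notMem (by simpa using hu), min_eq_left (by nlinarith)]
    have : ‖Complex.exp (Complex.I * (inner ℝ ξ u : ℝ)) - 1‖ ≤ 2 := by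
      refine (norm_sub_le _ _).trans ?_
      rw [mul_comm, Complex.norm_exp_ofReal_mul_I]; norm_num
    simp only [Complex.ofReal_zero, mul_zero, sub_zero]
    nlinarith [sq_nonneg ‖ξ‖]

theorem measurable_levyIntegrand (ξ : Euc d) : Measurable (levyIntegrand ξ) := by
  have : Measurable ((Metric.closedBall (0 : Euc d) 1).indicator
      (fun v => (inner ℝ ξ v : ℝ))) :=
    Measurable.indicator (by fun_prop) measurableSet_closedBall
  unfold levyIntegrand
  fun_prop

theorem IsLevyMeasure.integrable_levyIntegrand (h : IsLevyMeasure ν) (ξ : Euc d) :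
    Integrable (levyIntegrand ξ) ν :=
  (h.integrable_min_one_sq.const_mul _).mono' (measurable_levyIntegrand ξ).aestronglyMeasurable
    (ae_of_all _ fun u => norm_levyIntegrand_le ξ u)

theorem levyIntegrand_re (ξ u : Euc d) :
    (levyIntegrand ξ u).re = -(1 - Real.cos (inner ℝ ξ u)) := by
  rw [levyIntegrand, mul_comm Complex.I]
  simp [Complex.exp_ofReal_mul_I_re]

theorem IsLevyMeasure.integrable_one_sub_cos (h : IsLevyMeasure ν) (ξ : Euc d) :
    Integrable (fun u => 1 - Real.cos (inner ℝ ξ u)) ν := by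
  have := (h.integrable_levyIntegrand ξ).re.neg
  refine this.congr (ae_of_all _ fun u => ?_)
  simp [levyIntegrand_re]

variable {μ : Measure (Euc d)} {b : Euc d}

theorem IsInfDivTriplet.charFun_eq_exp (h : IsInfDivTriplet μ b 0 ν) (ξ : Euc d) :
    charFun μ ξ = Complex.exp (Complex.I * (inner ℝ b ξ : ℝ) + ∫ u, levyIntegrand ξ u ∂ν) := by
  rw [h.charFun_eq ξ]
  simp [levyIntegrand]

theorem IsInfDivTriplet.norm_charFun_eq (h : IsInfDivTriplet μ b 0 ν) (ξ : Euc d) :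
    ‖charFun μ ξ‖ = Real.exp (-∫ u, (1 - Real.cos (inner ℝ ξ u)) ∂ν) := by
  rw [h.charFun_eq_exp, Complex.norm_exp, ← integral_neg]
  congr 1
  have := integral_re (h.levy.integrable_levyIntegrand ξ)
  simp only [RCLike.re_eq_complex_re, levyIntegrand_re] at this
  simp [← this]

theorem re_charFun [IsProbabilityMeasure μ] (ξ : Euc d) :
    (charFun μ ξ).re = ∫ x, Real.cos (inner ℝ ξ x) ∂μ := by
  have hi : Integrable (fun x => Complex.exp ((inner ℝ x ξ : ℝ) * Complex.I)) μ :=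
    Integrable.of_bound (by fun_prop) 1 (ae_of_all _ fun x => by
      rw [Complex.norm_exp_ofReal_mul_I])
  have := integral_re hi
  simp only [RCLike.re_eq_complex_re, Complex.exp_ofReal_mul_I_re] at this
  rw [charFun_apply, ← this]
  simp only [real_inner_comm]

theorem integrable_cos_inner [IsProbabilityMeasure μ] (ξ : Euc d) :
    Integrable (fun x => Real.cos (inner ℝ ξ x)) μ :=
  Integrable.of_bound (by fun_prop) 1 (ae_of_all _ fun x => Real.abs_cos_le_one _)

/-- With `g` the left-hand integral, `|φ(ξ)| = e^{-g}`, and the hypothesis says `g ≤ 1`. Then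
`e^{-g} ≤ 1/(1+g) ≤ 1 - g/2`, while `Re φ ≤ |φ|`. -/
theorem IsInfDivTriplet.integral_one_sub_cos_le [IsProbabilityMeasure μ]
    (h : IsInfDivTriplet μ b 0 ν) {ξ : Euc d} (hξ : Real.exp (-1) ≤ ‖charFun μ ξ‖) :
    ∫ u, (1 - Real.cos (inner ℝ ξ u)) ∂ν ≤ 2 * ∫ x, (1 - Real.cos (inner ℝ ξ x)) ∂μ := by
  have h1 := h.norm_charFun_eq ξ
  have h2 : (charFun μ ξ).re ≤ ‖charFun μ ξ‖ := Complex.re_le_norm _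
  rw [re_charFun] at h2
  have h6 : ∫ x, (1 - Real.cos (inner ℝ ξ x)) ∂μ = 1 - ∫ x, Real.cos (inner ℝ ξ x) ∂μ := by
    rw [integral_sub (integrable_const _) (integrable_cos_inner ξ)]
    simp
  have h0 : 0 ≤ ∫ u, (1 - Real.cos (inner ℝ ξ u)) ∂ν :=
    integral_nonneg fun u => by simp [Real.cos_le_one]
  set g := ∫ u, (1 - Real.cos (inner ℝ ξ u)) ∂ν
  rw [h1, Real.exp_le_exp, neg_le_neg_iff] at hξ
  have h3 : Real.exp (-g) ≤ 1 - g / 2 := by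
    have h4 := Real.add_one_le_exp g
    have h5 : Real.exp (-g) ≤ 1 / (g + 1) := by
      rw [Real.exp_neg, ← one_div]
      exact one_div_le_one_div_of_le (by linarith) h4
    refine h5.trans ?_
    rw [div_le_iff₀ (by linarith)]
    nlinarith
  rw [h6]
  linarith

/-- For small `s` the comparison of `1 - cos⟨sη, u⟩` under `ν` and under `μ` is available;
integrating it against `ds/s²` turns both sides into first moments of `⟨η, ·⟩`. -/
theorem IsInfDivTriplet.lintegral_abs_inner_lt_top [IsProbabilityMeasure μ]
    (h : IsInfDivTriplet μ b 0 ν) (hμ : Integrable (fun x => x) μ) (η : Euc d) :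
    ∫⁻ u in (Metric.closedBall (0 : Euc d) 1)ᶜ, ENNReal.ofReal |inner ℝ η u| ∂ν < ⊤ := by
  have := h.levy.sFinite
  obtain ⟨δ, hδ, hδφ⟩ : ∃ δ > 0, ∀ s ∈ Ioo (0 : ℝ) δ, Real.exp (-1) ≤ ‖charFun μ (s • η)‖ := by
    have hc : Continuous fun s : ℝ => ‖charFun μ (s • η)‖ :=
      (continuous_charFun.comp (continuous_id.smul continuous_const)).norm
    have ht : ∀ᶠ s in 𝓝 (0 : ℝ), Real.exp (-1) < ‖charFun μ (s • η)‖ :=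
      hc.continuousAt.eventually_const_lt (by simp)
    obtain ⟨δ, hδ, hb⟩ := Metric.eventually_nhds_iff_ball.1 ht
    refine ⟨δ, hδ, fun s hs => (hb s ?_).le⟩
    rw [Real.ball_eq_Ioo]
    exact ⟨by linarith [hs.1], by linarith [hs.2]⟩
  set B := (Metric.closedBall (0 : Euc d) 1)ᶜ with hB
  have hνB : ν B < ⊤ := by
    refine lt_of_le_of_lt ?_ h.levy.lintegral_lt_top
    rw [← lintegral_indicator_one (by measurability)]
    refine lintegral_mono fun u => ?_
    by_cases hu : u ∈ B
    · rw [indicator_of_mem hu]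
      have : 1 < ‖u‖ := by simpa [hB] using hu
      rw [min_eq_left (by nlinarith)]; simp
    · rw [indicator_of_notMem hu]; exact zero_le
  let F : Euc d → ℝ → ℝ≥0∞ := fun u s =>
    ENNReal.ofReal ((1 - Real.cos (s * inner ℝ η u)) / s ^ 2)
  have hF : Measurable (Function.uncurry F) := by
    simp only [F, Function.uncurry_def]; fun_prop
  -- Where `|⟨η, u⟩| ≤ 1/δ` the lower bound fails, but a constant suffices because `ν B` is finite.
  have hpt (u : Euc d) : ENNReal.ofReal |inner ℝ η u|
      ≤ ENNReal.ofReal (1 / δ) + 8 * ∫⁻ s in Ioo 0 δ, F u s := by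
    rcases le_total (δ * |inner ℝ η u|) 1 with hu | hu
    · refine le_add_right (ENNReal.ofReal_le_ofReal ?_)
      rw [le_div_iff₀ hδ]; linarith
    · refine le_add_left ?_
      calc ENNReal.ofReal |inner ℝ η u| = 8 * ENNReal.ofReal (|inner ℝ η u| / 8) := by
            rw [show (8 : ℝ≥0∞) = ENNReal.ofReal 8 by simp,
              ← ENNReal.ofReal_mul (by norm_num)]
            congr 1; ring
        _ ≤ _ := by gcongr; exact le_lintegral_one_sub_cos_div_sq hδ hu
  have hs (s : ℝ) (hs : s ∈ Ioo 0 δ) : ∫⁻ u, F u s ∂ν ≤ 2 * ∫⁻ x, F x s ∂μ := by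
    have e (ρ : Measure (Euc d)) (hi : Integrable (fun u => 1 - Real.cos (inner ℝ (s • η) u)) ρ) :
        ∫⁻ u, F u s ∂ρ
          = ENNReal.ofReal ((∫ u, (1 - Real.cos (inner ℝ (s • η) u)) ∂ρ) / s ^ 2) := by
      rw [← integral_div, ofReal_integral_eq_lintegral_ofReal (hi.div_const _)
        (ae_of_all _ fun u => div_nonneg (by simp [Real.cos_le_one]) (sq_nonneg s))]
      simp [F, real_inner_smul_left]
    rw [e ν (h.levy.integrable_one_sub_cos _),
      e μ ((integrable_const 1).sub (integrable_cos_inner _))]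
    have htwo (a : ℝ) : 2 * ENNReal.ofReal a = ENNReal.ofReal (2 * a) := by
      rw [ENNReal.ofReal_mul zero_le_two, ENNReal.ofReal_ofNat]
    rw [htwo, ← mul_div_assoc]
    refine ENNReal.ofReal_le_ofReal ?_
    gcongr
    exact h.integral_one_sub_cos_le (hδφ s hs)
  have hdouble : ∫⁻ u, (∫⁻ s in Ioo 0 δ, F u s) ∂ν < ⊤ := by
    calc ∫⁻ u, (∫⁻ s in Ioo 0 δ, F u s) ∂ν = ∫⁻ s in Ioo 0 δ, ∫⁻ u, F u s ∂ν :=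
          lintegral_lintegral_swap hF.aemeasurable
      _ ≤ ∫⁻ s in Ioo 0 δ, 2 * ∫⁻ x, F x s ∂μ := setLIntegral_mono' measurableSet_Ioo hs
      _ = 2 * ∫⁻ s in Ioo 0 δ, ∫⁻ x, F x s ∂μ := lintegral_const_mul' _ _ (by simp)
      _ = 2 * ∫⁻ x, (∫⁻ s in Ioo 0 δ, F x s) ∂μ := by
          rw [lintegral_lintegral_swap hF.aemeasurable]
      _ ≤ 2 * ∫⁻ x, ENNReal.ofReal (3 * (‖η‖ * ‖x‖)) ∂μ := by
          gcongr with x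
          refine (lintegral_mono_set Ioo_subset_Ioi_self).trans
            ((lintegral_one_sub_cos_div_sq_le _).trans (ENNReal.ofReal_le_ofReal ?_))
          gcongr
          exact abs_real_inner_le_norm η x
      _ < ⊤ := ENNReal.mul_lt_top (by simp)
          ((hμ.norm.const_mul ‖η‖).const_mul 3).lintegral_lt_top
  calc ∫⁻ u in B, ENNReal.ofReal |inner ℝ η u| ∂ν
      ≤ ∫⁻ u in B, (ENNReal.ofReal (1 / δ) + 8 * ∫⁻ s in Ioo 0 δ, F u s) ∂ν :=
        lintegral_mono fun u => hpt u
    _ ≤ ENNReal.ofReal (1 / δ) * ν B + 8 * ∫⁻ u, (∫⁻ s in Ioo 0 δ, F u s) ∂ν := by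
        rw [lintegral_add_left measurable_const, setLIntegral_const,
          lintegral_const_mul' _ _ (by simp)]
        gcongr
        exact Measure.restrict_le_self
    _ < ⊤ := ENNReal.add_lt_top.2 ⟨ENNReal.mul_lt_top (by simp) hνB,
        ENNReal.mul_lt_top (by simp) hdouble⟩

theorem norm_le_sum_abs_inner (u : Euc d) :
    ‖u‖ ≤ ∑ i, |inner ℝ (EuclideanSpace.basisFun (Fin d) ℝ i) u| := by
  conv_lhs => rw [← (EuclideanSpace.basisFun (Fin d) ℝ).sum_repr' u]
  refine (norm_sum_le _ _).trans (Finset.sum_le_sum fun i _ => ?_)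
  simp [norm_smul]

/-- If an infinitely divisible law has a first moment, then so does its Lévy measure away from
the origin. -/
theorem IsInfDivTriplet.integrable_min_norm_sq [IsProbabilityMeasure μ]
    (h : IsInfDivTriplet μ b 0 ν) (hμ : Integrable (fun x => x) μ) :
    Integrable (fun u => min ‖u‖ (‖u‖ ^ 2)) ν := by
  rw [← integrableOn_univ, ← union_compl_self (Metric.closedBall (0 : Euc d) 1)]
  refine IntegrableOn.union ?_ ?_
  · refine (h.levy.integrable_min_one_sq.integrableOn).congr_fun (fun u hu => ?_)
      measurableSet_closedBall
    have hu' : ‖u‖ ≤ 1 := by simpa using hu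
    have := norm_nonneg u
    simp only
    rw [min_eq_right (by nlinarith), min_eq_right (by nlinarith)]
  · have hi : ∀ i ∈ Finset.univ, IntegrableOn
        (fun u => |inner ℝ (EuclideanSpace.basisFun (Fin d) ℝ i) u|)
        (Metric.closedBall (0 : Euc d) 1)ᶜ ν := fun i _ => by
      refine ⟨by fun_prop, ?_⟩
      rw [hasFiniteIntegral_iff_ofReal (ae_of_all _ fun u => abs_nonneg _)]
      exact h.lintegral_abs_inner_lt_top hμ _
    refine (integrable_finsetSum _ hi).mono' (by fun_prop) (ae_of_all _ fun u => ?_)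
    rw [Real.norm_of_nonneg (by positivity)]
    exact (min_le_left _ _).trans (norm_le_sum_abs_inner u)

end

/-! ### The exponent with untruncated compensator, and its derivatives along rays. -/

section

variable {d : ℕ} {μ ν : Measure (Euc d)} {b : Euc d}

theorem norm_exp_I_mul_sub_one_le_two (x : ℝ) : ‖Complex.exp (Complex.I * x) - 1‖ ≤ 2 := by
  refine (norm_sub_le _ _).trans ?_
  rw [mul_comm, Complex.norm_exp_ofReal_mul_I]; norm_num

theorem norm_inner_mul_exp_sub_one_le (ξ u : Euc d) (s : ℝ) :
    ‖Complex.I * (inner ℝ ξ u : ℝ) * (Complex.exp (Complex.I * (s * inner ℝ ξ u : ℝ)) - 1)‖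
      ≤ (2 * ‖ξ‖ + |s| * ‖ξ‖ ^ 2) * min ‖u‖ (‖u‖ ^ 2) := by
  have hy := abs_real_inner_le_norm ξ u
  set y : ℝ := inner ℝ ξ u
  rw [norm_mul, norm_mul, Complex.norm_I, one_mul, Complex.norm_real, Real.norm_eq_abs]
  have h0 := abs_nonneg y
  have hs := abs_nonneg s
  have hξ := norm_nonneg ξ
  have hu := norm_nonneg u
  rcases le_total ‖u‖ 1 with h | h
  · rw [min_eq_right (by nlinarith)]
    have h1 : ‖Complex.exp (Complex.I * (s * y : ℝ)) - 1‖ ≤ |s| * |y| := by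
      rw [← abs_mul]; exact Real.norm_exp_I_mul_ofReal_sub_one_le
    calc _ ≤ |y| * (|s| * |y|) := by gcongr
      _ = |s| * |y| ^ 2 := by ring
      _ ≤ |s| * (‖ξ‖ * ‖u‖) ^ 2 := by gcongr
      _ = |s| * ‖ξ‖ ^ 2 * ‖u‖ ^ 2 := by ring
      _ ≤ _ := by gcongr; linarith
  · rw [min_eq_left (by nlinarith)]
    calc _ ≤ (‖ξ‖ * ‖u‖) * 2 := by gcongr; exact norm_exp_I_mul_sub_one_le_two _
      _ = (2 * ‖ξ‖) * ‖u‖ := by ring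
      _ ≤ _ := by gcongr; nlinarith

theorem norm_exp_inner_sub_one_sub_le (ξ u : Euc d) :
    ‖Complex.exp (Complex.I * (inner ℝ ξ u : ℝ)) - 1 - Complex.I * (inner ℝ ξ u : ℝ)‖
      ≤ 2 * (‖ξ‖ + ‖ξ‖ ^ 2) * min ‖u‖ (‖u‖ ^ 2) := by
  have hy := abs_real_inner_le_norm ξ u
  set y : ℝ := inner ℝ ξ u
  have hξ := norm_nonneg ξ
  have hu := norm_nonneg u
  rcases le_total ‖u‖ 1 with h | h
  · rw [min_eq_right (by nlinarith)]
    calc _ ≤ 2 * |y| ^ 2 := by rw [sq_abs]; exact norm_exp_I_mul_sub_one_sub_le y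
      _ ≤ 2 * (‖ξ‖ * ‖u‖) ^ 2 := by gcongr
      _ = 2 * ‖ξ‖ ^ 2 * ‖u‖ ^ 2 := by ring
      _ ≤ _ := by gcongr; linarith
  · rw [min_eq_left (by nlinarith)]
    calc _ ≤ |y| + |y| := by
          refine (norm_sub_le _ _).trans (add_le_add Real.norm_exp_I_mul_ofReal_sub_one_le ?_)
          simp
      _ ≤ 2 * (‖ξ‖ * ‖u‖) := by linarith
      _ = 2 * ‖ξ‖ * ‖u‖ := by ring
      _ ≤ _ := by gcongr; nlinarith

/-- The Lévy–Khintchine exponent with mean `m`, for Lévy measures with a first moment. -/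
noncomputable def levyExp (ν : Measure (Euc d)) (m ξ : Euc d) : ℂ :=
  Complex.I * (inner ℝ m ξ : ℝ)
    + ∫ u, (Complex.exp (Complex.I * (inner ℝ ξ u : ℝ)) - 1 - Complex.I * (inner ℝ ξ u : ℝ)) ∂ν

/-- The radial derivative `⟨ξ, ∇ψ(ξ)⟩` of the exponent `ψ = levyExp ν m`. -/
noncomputable def levySymbol (ν : Measure (Euc d)) (m ξ : Euc d) : ℂ :=
  Complex.I * (inner ℝ m ξ : ℝ)
    + ∫ u, Complex.I * (inner ℝ ξ u : ℝ) * (Complex.exp (Complex.I * (inner ℝ ξ u : ℝ)) - 1) ∂ν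

theorem integrable_exp_inner_sub_one_sub (hK : Integrable (fun u => min ‖u‖ (‖u‖ ^ 2)) ν)
    (ξ : Euc d) :
    Integrable (fun u => Complex.exp (Complex.I * (inner ℝ ξ u : ℝ)) - 1
      - Complex.I * (inner ℝ ξ u : ℝ)) ν :=
  (hK.const_mul _).mono' (by fun_prop)
    (ae_of_all _ fun u => norm_exp_inner_sub_one_sub_le ξ u)

/-- Differentiation under the integral; on the unit ball around `s` the parameter is at most `|s| +
1`, which gives a dominating multiple of `min ‖u‖ ‖u‖²`. -/
theorem hasDerivAt_levyExp_smul (hK : Integrable (fun u => min ‖u‖ (‖u‖ ^ 2)) ν)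
    (m ξ : Euc d) (s : ℝ) :
    HasDerivAt (fun s : ℝ => levyExp ν m (s • ξ))
      (Complex.I * (inner ℝ m ξ : ℝ) + ∫ u, Complex.I * (inner ℝ ξ u : ℝ) *
        (Complex.exp (Complex.I * (s * inner ℝ ξ u : ℝ)) - 1) ∂ν) s := by
  unfold levyExp
  have hcoe (y : ℝ) (r : ℝ) :
      HasDerivAt (fun r : ℝ => Complex.I * ((r * y : ℝ) : ℂ)) (Complex.I * y) r := by
    simpa using (((hasDerivAt_id r).mul_const y).ofReal_comp).const_mul Complex.I
  refine HasDerivAt.add ?_ ?_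
  · simpa only [real_inner_smul_right] using hcoe (inner ℝ m ξ) s
  · simp only [real_inner_smul_left]
    refine (hasDerivAt_integral_of_dominated_loc_of_deriv_le (μ := ν) (x₀ := s)
      (F := fun s u => Complex.exp (Complex.I * (s * inner ℝ ξ u : ℝ)) - 1
        - Complex.I * (s * inner ℝ ξ u : ℝ))
      (F' := fun s u => Complex.I * (inner ℝ ξ u : ℝ) *
        (Complex.exp (Complex.I * (s * inner ℝ ξ u : ℝ)) - 1))
      (bound := fun u => (2 * ‖ξ‖ + (|s| + 1) * ‖ξ‖ ^ 2) * min ‖u‖ (‖u‖ ^ 2))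
      (Metric.ball_mem_nhds s one_pos) (Eventually.of_forall fun r => by fun_prop)
      ?_ (by fun_prop) (ae_of_all _ fun u r hr => ?_) (hK.const_mul _)
      (ae_of_all _ fun u r _ => ?_)).2
    · simpa only [real_inner_smul_left] using integrable_exp_inner_sub_one_sub hK (s • ξ)
    · refine (norm_inner_mul_exp_sub_one_le ξ u r).trans ?_
      have : |r| ≤ |s| + 1 := by
        have h1 := abs_add_le (r - s) s
        rw [Metric.mem_ball, Real.dist_eq] at hr
        rw [sub_add_cancel] at h1
        linarith
      gcongr
    · have h1 := hcoe (inner ℝ ξ u) r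
      exact ((h1.cexp.sub_const 1).sub h1).congr_deriv (by ring)

theorem hasDerivAt_levyExp_exp_neg_smul (hK : Integrable (fun u => min ‖u‖ (‖u‖ ^ 2)) ν)
    (m ξ : Euc d) (t : ℝ) :
    HasDerivAt (fun t : ℝ => levyExp ν m (Real.exp (-t) • ξ))
      (-levySymbol ν m (Real.exp (-t) • ξ)) t := by
  have h1 : HasDerivAt (fun t : ℝ => Real.exp (-t)) (-Real.exp (-t)) t := by
    simpa using (hasDerivAt_neg t).exp
  refine ((hasDerivAt_levyExp_smul hK m ξ (Real.exp (-t))).scomp t h1).congr_deriv ?_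
  rw [levySymbol, Complex.real_smul, mul_add, ← integral_const_mul, neg_add, ← integral_neg,
    real_inner_smul_right]
  congr 1
  · push_cast; ring
  · congr 1 with u
    rw [real_inner_smul_left]
    push_cast; ring

theorem norm_levySymbol_le (hK : Integrable (fun u => min ‖u‖ (‖u‖ ^ 2)) ν) (m ξ : Euc d) :
    ‖levySymbol ν m ξ‖
      ≤ (‖m‖ + 2 * ∫ u, min ‖u‖ (‖u‖ ^ 2) ∂ν) * (‖ξ‖ + ‖ξ‖ ^ 2) := by
  have h0 : 0 ≤ ∫ u, min ‖u‖ (‖u‖ ^ 2) ∂ν := integral_nonneg fun u => by positivity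
  have h1 : ‖∫ u, Complex.I * (inner ℝ ξ u : ℝ) *
      (Complex.exp (Complex.I * (inner ℝ ξ u : ℝ)) - 1) ∂ν‖
      ≤ (2 * ‖ξ‖ + ‖ξ‖ ^ 2) * ∫ u, min ‖u‖ (‖u‖ ^ 2) ∂ν := by
    rw [← integral_const_mul]
    refine norm_integral_le_of_norm_le (hK.const_mul _) (ae_of_all _ fun u => ?_)
    simpa using norm_inner_mul_exp_sub_one_le ξ u 1
  have h2 : ‖Complex.I * ((inner ℝ m ξ : ℝ) : ℂ)‖ ≤ ‖m‖ * ‖ξ‖ := by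
    simpa using abs_real_inner_le_norm m ξ
  refine (norm_add_le _ _).trans ((add_le_add h2 h1).trans ?_)
  nlinarith [mul_nonneg (norm_nonneg m) (sq_nonneg ‖ξ‖), mul_nonneg h0 (sq_nonneg ‖ξ‖)]

theorem hasDerivAt_charFun_smul_zero [IsProbabilityMeasure μ] (hμ : Integrable (fun x => x) μ)
    (ξ : Euc d) :
    HasDerivAt (fun s : ℝ => charFun μ (s • ξ))
      (Complex.I * (inner ℝ (∫ x, x ∂μ) ξ : ℝ)) 0 := by
  have hcoe (y : ℝ) (r : ℝ) :
      HasDerivAt (fun r : ℝ => ((r * y : ℝ) : ℂ) * Complex.I) (y * Complex.I) r := by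
    simpa using (((hasDerivAt_id r).mul_const y).ofReal_comp).mul_const Complex.I
  simp only [charFun_apply, real_inner_smul_right]
  have := (hasDerivAt_integral_of_dominated_loc_of_deriv_le (μ := μ) (x₀ := (0 : ℝ))
      (F := fun s x => Complex.exp ((s * inner ℝ x ξ : ℝ) * Complex.I))
      (F' := fun s x => Complex.exp ((s * inner ℝ x ξ : ℝ) * Complex.I)
        * ((inner ℝ x ξ : ℝ) * Complex.I))
      (bound := fun x => ‖x‖ * ‖ξ‖)
      (Metric.ball_mem_nhds 0 one_pos) (Eventually.of_forall fun r => by fun_prop)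
      (by simp) (by fun_prop) (ae_of_all _ fun x r hr => ?_) (hμ.norm.mul_const _)
      (ae_of_all _ fun x r _ => ?_)).2
  · refine this.congr_deriv ?_
    simp only [zero_mul, Complex.ofReal_zero, Complex.exp_zero, one_mul]
    rw [integral_mul_const, integral_complex_ofReal, mul_comm, real_inner_comm,
      ← integral_inner hμ]
    simp only [real_inner_comm]
  · rw [norm_mul, Complex.norm_exp_ofReal_mul_I]
    simpa using abs_real_inner_le_norm x ξ
  · exact (hcoe (inner ℝ x ξ) r).cexp

/-- Removing the truncation changes the exponent by a term linear in `ξ`, namely `i⟨ξ, ∫_{‖u‖>1} u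
ν(du)⟩`, which is absorbed into the drift. -/
theorem IsInfDivTriplet.exists_charFun_eq_exp_levyExp (h : IsInfDivTriplet μ b 0 ν)
    (hK : Integrable (fun u => min ‖u‖ (‖u‖ ^ 2)) ν) :
    ∃ m : Euc d, ∀ ξ, charFun μ ξ = Complex.exp (levyExp ν m ξ) := by
  set B := (Metric.closedBall (0 : Euc d) 1)ᶜ with hB
  have hBm : MeasurableSet B := measurableSet_closedBall.compl
  have hi : IntegrableOn (fun u => u) B ν := by
    refine hK.integrableOn.mono' (by fun_prop) ((ae_restrict_iff' hBm).2 (ae_of_all _ fun u hu => ?_))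
    have : 1 < ‖u‖ := by simpa [hB] using hu
    rw [min_eq_left (by nlinarith)]
  refine ⟨b + ∫ u in B, u ∂ν, fun ξ => ?_⟩
  rw [h.charFun_eq_exp, levyExp]
  congr 1
  have e (u : Euc d) : levyIntegrand ξ u = (Complex.exp (Complex.I * (inner ℝ ξ u : ℝ)) - 1
      - Complex.I * (inner ℝ ξ u : ℝ))
      + Complex.I * (B.indicator (fun v => (inner ℝ ξ v : ℝ)) u : ℝ) := by
    rw [levyIntegrand]
    by_cases hu : u ∈ B
    · rw [indicator_of_mem hu, indicator_of_notMem (by simpa [hB] using hu)]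
      push_cast; ring
    · rw [indicator_of_notMem hu, indicator_of_mem (by simpa [hB] using hu)]
      push_cast; ring
  simp only [e]
  have hi2 : Integrable (B.indicator fun v => (inner ℝ ξ v : ℝ)) ν :=
    (integrable_indicator_iff hBm).2 (hi.const_inner ξ)
  have hi3 : Integrable (fun u => Complex.I * ((B.indicator (fun v => (inner ℝ ξ v : ℝ)) u : ℝ) : ℂ))
      ν := hi2.ofReal.const_mul _
  rw [integral_add (integrable_exp_inner_sub_one_sub hK ξ) hi3,
    integral_const_mul, integral_complex_ofReal, integral_indicator hBm, integral_inner hi,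
    inner_add_left, real_inner_comm ξ (∫ u in B, u ∂ν)]
  push_cast; ring

/-- An infinitely divisible law with a first moment and no Gaussian part has exponent
`i⟨m, ξ⟩ + ∫ (e^{i⟨ξ, u⟩} - 1 - i⟨ξ, u⟩) ν(du)`, with `m` its mean. -/
theorem IsInfDivTriplet.charFun_eq_exp_levyExp [IsProbabilityMeasure μ]
    (h : IsInfDivTriplet μ b 0 ν) (hμ : Integrable (fun x => x) μ) (ξ : Euc d) :
    charFun μ ξ = Complex.exp (levyExp ν (∫ x, x ∂μ) ξ) := by
  have hK := h.integrable_min_norm_sq hμ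
  obtain ⟨m, hm⟩ := h.exists_charFun_eq_exp_levyExp hK
  suffices e : m = ∫ x, x ∂μ by rw [← e, hm]
  -- The drift is identified by differentiating `s ↦ φ(sη)` at `0` in two ways; the jump integral
  -- contributes nothing there, since `e^0 - 1 = 0`.
  refine ext_inner_right ℝ fun η => ?_
  have h1 := hasDerivAt_charFun_smul_zero hμ η
  have h2 := (hasDerivAt_levyExp_smul hK m η 0).cexp
  simp only [← hm] at h2
  have h3 := h1.unique h2
  simpa using h3.symm

end

/-! ### Fourier inversion for Schwartz functions and their gradients. -/

section

open scoped FourierTransform in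
theorem fourierS_eq {d : ℕ} (f : 𝓢(Euc d, ℝ)) (ξ : Euc d) :
    fourierS f ξ
      = 𝓕 (f.postcompCLM Complex.ofRealCLM : 𝓢(Euc d, ℂ)) ((2 * Real.pi)⁻¹ • ξ) := by
  rw [SchwartzMap.fourier_coe, Real.fourier_eq', fourierS]
  congr 1 with x
  rw [SchwartzMap.postcompCLM_apply, smul_eq_mul, mul_comm, real_inner_smul_right,
    real_inner_comm]
  congr 2
  have : (Real.pi : ℂ) ≠ 0 := by exact_mod_cast Real.pi_ne_zero
  push_cast
  field_simp

variable {d : ℕ} (f : 𝓢(Euc d, ℝ))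

theorem continuous_fourierS : Continuous (fourierS f) := by
  rw [funext (fourierS_eq f)]
  fun_prop

theorem integrable_norm_pow_mul_norm_fourierS (n : ℕ) :
    Integrable (fun ξ => ‖ξ‖ ^ n * ‖fourierS f ξ‖) := by
  open scoped FourierTransform in
  have h := ((𝓕 (f.postcompCLM Complex.ofRealCLM : 𝓢(Euc d, ℂ))).integrable_pow_mul
    volume n).comp_smul (R := (2 * Real.pi)⁻¹) (by positivity)
  refine (h.const_mul ((2 * Real.pi) ^ n)).congr (ae_of_all _ fun ξ => ?_)
  simp only [fourierS_eq, norm_smul, mul_pow]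
  rw [Real.norm_of_nonneg (by positivity), inv_pow, ← mul_assoc, ← mul_assoc, ← mul_pow,
    mul_inv_cancel₀ (by positivity), one_mul]

theorem integrable_fourierS : Integrable (fourierS f) := by
  rw [← integrable_norm_iff (continuous_fourierS f).aestronglyMeasurable]
  simpa using integrable_norm_pow_mul_norm_fourierS f 0

/-- Fourier inversion. -/
theorem ofReal_eq_integral_fourierS (y : Euc d) :
    (f y : ℂ) = (1 / (2 * Real.pi : ℂ) ^ d) *
      ∫ ξ, fourierS f ξ * Complex.exp (Complex.I * (inner ℝ y ξ : ℝ)) := by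
  open scoped FourierTransform in
  have h : (f.postcompCLM Complex.ofRealCLM : 𝓢(Euc d, ℂ)) y
      = 𝓕⁻ (𝓕 (f.postcompCLM Complex.ofRealCLM : 𝓢(Euc d, ℂ))) y := by
    rw [FourierTransform.fourierInv_fourier_eq]
  rw [SchwartzMap.postcompCLM_apply, SchwartzMap.fourierInv_coe, Real.fourierInv_eq'] at h
  change (f y : ℂ) = _ at h
  rw [h]
  simp only [fourierS_eq]
  have e := Measure.integral_comp_smul (volume : Measure (Euc d))
    (fun w => 𝓕 (f.postcompCLM Complex.ofRealCLM : 𝓢(Euc d, ℂ)) w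
      * Complex.exp (Complex.I * ((2 * Real.pi) * inner ℝ y w : ℝ))) (2 * Real.pi)⁻¹
  have e2 (ξ : Euc d) : (2 * Real.pi) * inner ℝ y ((2 * Real.pi)⁻¹ • ξ) = inner ℝ y ξ := by
    rw [real_inner_smul_right]; field_simp
  simp only [e2] at e
  rw [e, Complex.real_smul, finrank_euclideanSpace_fin, ← mul_assoc]
  have e3 : (1 / (2 * Real.pi : ℂ) ^ d) * ((|(((2 * Real.pi)⁻¹) ^ d)⁻¹| : ℝ) : ℂ) = 1 := by
    rw [abs_of_pos (by positivity)]
    have : (Real.pi : ℂ) ≠ 0 := by exact_mod_cast Real.pi_ne_zero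
    push_cast
    rw [inv_pow, inv_inv, one_div, inv_mul_cancel₀ (pow_ne_zero _ (mul_ne_zero two_ne_zero this))]
  rw [e3, one_mul]
  congr 1 with w
  rw [smul_eq_mul, mul_comm, real_inner_comm]
  congr 2
  push_cast; ring

theorem hasDerivAt_line (y v : Euc d) :
    HasDerivAt (fun s : ℝ => f (y + s • v)) (inner ℝ (gradient f y) v) 0 := by
  have h1 : HasFDerivAt f (fderiv ℝ f y) (y + (0 : ℝ) • v) := by
    simpa using f.differentiableAt.hasFDerivAt
  have h2 : HasDerivAt (fun s : ℝ => y + s • v) v 0 := by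
    simpa using ((hasDerivAt_id (0 : ℝ)).smul_const v).const_add y
  refine (h1.comp_hasDerivAt 0 h2).congr_deriv ?_
  rw [inner_gradient_left]

/-- The inversion formula is differentiated along the line `y + s v`, with `‖v‖ ‖ξ‖ |F f(ξ)|` as
dominating function. -/
theorem inner_gradient_eq_integral_fourierS (y v : Euc d) :
    ((inner ℝ (gradient f y) v : ℝ) : ℂ) = (1 / (2 * Real.pi : ℂ) ^ d) *
      ∫ ξ, fourierS f ξ * (Complex.I * (inner ℝ v ξ : ℝ)
        * Complex.exp (Complex.I * (inner ℝ y ξ : ℝ))) := by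
  have h1 := (hasDerivAt_line f y v).ofReal_comp
  simp only [ofReal_eq_integral_fourierS f] at h1
  have hcoe (ξ : Euc d) (r : ℝ) : HasDerivAt
      (fun r : ℝ => Complex.I * ((inner ℝ (y + r • v) ξ : ℝ) : ℂ))
      (Complex.I * (inner ℝ v ξ : ℝ)) r := by
    simp only [inner_add_left, real_inner_smul_left]
    simpa using ((((hasDerivAt_id r).mul_const (inner ℝ v ξ)).const_add
      (inner ℝ y ξ)).ofReal_comp).const_mul Complex.I
  have hfm := (continuous_fourierS f).measurable
  have h2 := (hasDerivAt_integral_of_dominated_loc_of_deriv_le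
      (μ := (volume : Measure (Euc d))) (x₀ := (0 : ℝ))
      (F := fun s ξ => fourierS f ξ * Complex.exp (Complex.I * (inner ℝ (y + s • v) ξ : ℝ)))
      (F' := fun s ξ => fourierS f ξ * (Complex.I * (inner ℝ v ξ : ℝ)
        * Complex.exp (Complex.I * (inner ℝ (y + s • v) ξ : ℝ))))
      (bound := fun ξ => ‖v‖ * (‖ξ‖ ^ 1 * ‖fourierS f ξ‖))
      (Metric.ball_mem_nhds 0 one_pos) (Eventually.of_forall fun r => by fun_prop)
      ?_ (by fun_prop) (ae_of_all _ fun ξ r hr => ?_)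
      ((integrable_norm_pow_mul_norm_fourierS f 1).const_mul _)
      (ae_of_all _ fun ξ r _ => ?_)).2
  · have h3 := h1.unique (h2.const_mul (1 / (2 * Real.pi : ℂ) ^ d))
    simpa using h3
  · refine (integrable_fourierS f).mono (by fun_prop) (ae_of_all _ fun ξ => ?_)
    rw [norm_mul, mul_comm Complex.I, Complex.norm_exp_ofReal_mul_I, mul_one]
  · rw [norm_mul, norm_mul, mul_comm Complex.I (((inner ℝ (y + r • v) ξ : ℝ) : ℂ)),
      Complex.norm_exp_ofReal_mul_I]
    have := abs_real_inner_le_norm v ξ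
    simp only [norm_mul, Complex.norm_I, one_mul, Complex.norm_real, Real.norm_eq_abs, mul_one,
      pow_one]
    nlinarith [norm_nonneg (fourierS f ξ)]
  · refine ((hcoe ξ r).cexp.const_mul (fourierS f ξ)).congr_deriv ?_
    ring

end

/-! ### Averaging operators on `L¹(μ)`. -/

section

variable {d : ℕ} {μ ρ : Measure (Euc d)} {r : ℝ}

theorem charFun_map_add_smul (μ ρ : Measure (Euc d)) [IsProbabilityMeasure μ]
    [IsProbabilityMeasure ρ] (r : ℝ) (ξ : Euc d) :
    charFun ((μ.prod ρ).map fun p => p.2 + r • p.1) ξ = charFun μ (r • ξ) * charFun ρ ξ := by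
  simp only [charFun_apply]
  rw [integral_map (by fun_prop) (by fun_prop), ← integral_prod_mul]
  congr 1 with p
  rw [← Complex.exp_add, inner_add_left, real_inner_smul_left, real_inner_smul_right]
  congr 1
  push_cast; ring

/-- Used with `τ = μ` for invariance, and with `μ_s`, `μ_t`, `μ_{s+t}` for the semigroup law. -/
theorem measurePreserving_add_smul {τ : Measure (Euc d)} [IsProbabilityMeasure μ]
    [IsProbabilityMeasure ρ] [IsProbabilityMeasure τ]
    (h : ∀ ξ, charFun τ ξ = charFun μ (r • ξ) * charFun ρ ξ) :
    MeasurePreserving (fun p : Euc d × Euc d => p.2 + r • p.1) (μ.prod ρ) τ := by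
  have hm : Measurable fun p : Euc d × Euc d => p.2 + r • p.1 := by fun_prop
  have := Measure.isProbabilityMeasure_map (μ := μ.prod ρ) hm.aemeasurable
  refine ⟨hm, Measure.ext_of_charFun ?_⟩
  ext ξ
  rw [charFun_map_add_smul, h]

section Average

variable {f g : Euc d → ℝ}

theorem integrable_comp_add_smul
    (h : MeasurePreserving (fun p : Euc d × Euc d => p.2 + r • p.1) (μ.prod ρ) μ)
    (hf : Integrable f μ) :
    Integrable (fun p : Euc d × Euc d => f (p.2 + r • p.1)) (μ.prod ρ) :=
  h.integrable_comp_of_integrable hf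

theorem ae_integrable_average [IsProbabilityMeasure μ] [IsProbabilityMeasure ρ]
    (h : MeasurePreserving (fun p : Euc d × Euc d => p.2 + r • p.1) (μ.prod ρ) μ)
    (hf : Integrable f μ) :
    ∀ᵐ x ∂μ, Integrable (fun u => f (u + r • x)) ρ :=
  (integrable_comp_add_smul h hf).prod_right_ae

theorem integrable_average [IsProbabilityMeasure μ] [IsProbabilityMeasure ρ]
    (h : MeasurePreserving (fun p : Euc d × Euc d => p.2 + r • p.1) (μ.prod ρ) μ)
    (hf : Integrable f μ) :
    Integrable (fun x => ∫ u, f (u + r • x) ∂ρ) μ :=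
  (integrable_comp_add_smul h hf).integral_prod_left

/-- Makes the average well defined on classes: `μ`-null sets pull back to null sets of the product,
whose slices are null for almost every `x`. -/
theorem average_congr [SFinite ρ]
    (h : MeasurePreserving (fun p : Euc d × Euc d => p.2 + r • p.1) (μ.prod ρ) μ)
    (hfg : f =ᵐ[μ] g) :
    (fun x => ∫ u, f (u + r • x) ∂ρ) =ᵐ[μ] fun x => ∫ u, g (u + r • x) ∂ρ := by
  have := Measure.ae_ae_of_ae_prod (h.quasiMeasurePreserving.ae_eq_comp hfg)
  filter_upwards [this] with x hx
  exact integral_congr_ae hx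

theorem integral_average [IsProbabilityMeasure μ] [IsProbabilityMeasure ρ]
    (h : MeasurePreserving (fun p : Euc d × Euc d => p.2 + r • p.1) (μ.prod ρ) μ)
    (hf : Integrable f μ) :
    ∫ x, (∫ u, f (u + r • x) ∂ρ) ∂μ = ∫ x, f x ∂μ := by
  rw [← integral_prod _ (integrable_comp_add_smul h hf)]
  conv_rhs => rw [← h.map_eq]
  rw [integral_map h.measurable.aemeasurable (by rw [h.map_eq]; exact hf.aestronglyMeasurable)]

/-- The operator `f ↦ (x ↦ ∫ f(u + r x) ρ(du))` on `L¹(μ)`. -/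
noncomputable def averageL1 [IsProbabilityMeasure μ] [IsProbabilityMeasure ρ]
    (h : MeasurePreserving (fun p : Euc d × Euc d => p.2 + r • p.1) (μ.prod ρ) μ)
    : Lp ℝ 1 μ →L[ℝ] Lp ℝ 1 μ :=
  LinearMap.mkContinuous
    { toFun := fun g => (integrable_average h (L1.integrable_coeFn g)).toL1 _
      map_add' := fun g₁ g₂ => by
        rw [← Integrable.toL1_add, Integrable.toL1_eq_toL1_iff]
        filter_upwards [average_congr h (Lp.coeFn_add g₁ g₂),
          ae_integrable_average h (L1.integrable_coeFn g₁),
          ae_integrable_average h (L1.integrable_coeFn g₂)] with x hx h₁ h₂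
        rw [hx]
        exact integral_add h₁ h₂
      map_smul' := fun c g => by
        rw [RingHom.id_apply, ← Integrable.toL1_smul, Integrable.toL1_eq_toL1_iff]
        filter_upwards [average_congr h (Lp.coeFn_smul c g)] with x hx
        rw [hx]
        exact integral_const_mul _ _ }
    -- Contractivity: the norm of the average is at most the average of `|g|`, whose integral is
    -- `‖g‖` by invariance.
    1 (fun g => by
      have hg := L1.integrable_coeFn g
      rw [one_mul, LinearMap.coe_mk, AddHom.coe_mk, L1.norm_of_fun_eq_integral_norm,
        L1.norm_eq_integral_norm, ← integral_average h hg.norm]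
      exact integral_mono (integrable_average h hg).norm (integrable_average h hg.norm)
        fun x => norm_integral_le_integral_norm _)

theorem norm_averageL1_le [IsProbabilityMeasure μ] [IsProbabilityMeasure ρ]
    (h : MeasurePreserving (fun p : Euc d × Euc d => p.2 + r • p.1) (μ.prod ρ) μ)
    : ‖averageL1 h‖ ≤ 1 := LinearMap.mkContinuous_norm_le _ zero_le_one _

theorem averageL1_coeFn [IsProbabilityMeasure μ] [IsProbabilityMeasure ρ]
    (h : MeasurePreserving (fun p : Euc d × Euc d => p.2 + r • p.1) (μ.prod ρ) μ)
    (g : Lp ℝ 1 μ) :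
    averageL1 h g =ᵐ[μ] fun x => ∫ u, g (u + r • x) ∂ρ :=
  Integrable.coeFn_toL1 (integrable_average h (L1.integrable_coeFn g))

theorem averageL1_toL1 [IsProbabilityMeasure μ] [IsProbabilityMeasure ρ]
    (h : MeasurePreserving (fun p : Euc d × Euc d => p.2 + r • p.1) (μ.prod ρ) μ)
    (hf : Integrable f μ) :
    averageL1 h (hf.toL1 f) =ᵐ[μ] fun x => ∫ u, f (u + r • x) ∂ρ :=
  (averageL1_coeFn h _).trans (average_congr h hf.coeFn_toL1)

end Average

/-- By `h₃` an average over `ρ` is an iterated average over `ρ₁` and `ρ₂`. Fubini applies for almost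
every `x`, where the outer average is integrable. -/
theorem averageL1_comp {ρ₁ ρ₂ : Measure (Euc d)} {r₁ r₂ : ℝ} [IsProbabilityMeasure μ]
    [IsProbabilityMeasure ρ] [IsProbabilityMeasure ρ₁] [IsProbabilityMeasure ρ₂]
    (h : MeasurePreserving (fun p : Euc d × Euc d => p.2 + r • p.1) (μ.prod ρ) μ)
    (h₁ : MeasurePreserving (fun p : Euc d × Euc d => p.2 + r₁ • p.1) (μ.prod ρ₁) μ)
    (h₂ : MeasurePreserving (fun p : Euc d × Euc d => p.2 + r₂ • p.1) (μ.prod ρ₂) μ)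
    (h₃ : MeasurePreserving (fun p : Euc d × Euc d => p.2 + r₂ • p.1) (ρ₁.prod ρ₂) ρ)
    (hr : r = r₁ * r₂) :
    averageL1 h = (averageL1 h₁).comp (averageL1 h₂) := by
  ext1 g
  refine Lp.ext ?_
  have hg := L1.integrable_coeFn g
  filter_upwards [averageL1_coeFn h g, averageL1_coeFn h₁ (averageL1 h₂ g),
    average_congr h₁ (averageL1_coeFn h₂ g), ae_integrable_average h hg] with x h4 h5 h6 h7
  rw [h4, ContinuousLinearMap.comp_apply, h5, h6]
  have h8 := h₃.integrable_comp_of_integrable h7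
  calc ∫ u, g (u + r • x) ∂ρ
      = ∫ p, g (p.2 + r₂ • p.1 + r • x) ∂(ρ₁.prod ρ₂) := by
        conv_lhs => rw [← h₃.map_eq]
        rw [integral_map h₃.measurable.aemeasurable
          (by rw [h₃.map_eq]; exact h7.aestronglyMeasurable)]
    _ = ∫ u, (∫ v, g (v + r₂ • u + r • x) ∂ρ₂) ∂ρ₁ := integral_prod _ h8
    _ = _ := by
        simp only [smul_add, smul_smul, hr, mul_comm r₂, add_assoc]

theorem tendsto_of_dense_of_norm_le {Y : Type*} [NormedAddCommGroup Y] [NormedSpace ℝ Y]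
    {ι : Type*} {l : Filter ι} {T : ι → Y →L[ℝ] Y} (hT : ∀ i, ‖T i‖ ≤ 1) {S : Set Y}
    (hS : Dense S) (h : ∀ y ∈ S, Tendsto (fun i => T i y) l (𝓝 y)) (y : Y) :
    Tendsto (fun i => T i y) l (𝓝 y) := by
  rw [Metric.tendsto_nhds]
  intro ε hε
  obtain ⟨z, hz, hyz⟩ := hS.exists_dist_lt y (ε := ε / 3) (by positivity)
  filter_upwards [Metric.tendsto_nhds.1 (h z hz) (ε / 3) (by positivity)] with i hi
  have h1 : dist (T i y) (T i z) ≤ dist y z := by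
    rw [dist_eq_norm, dist_eq_norm, ← map_sub]
    simpa using (T i).le_of_opNorm_le (hT i) (y - z)
  calc dist (T i y) y ≤ dist (T i y) (T i z) + dist (T i z) z + dist z y := dist_triangle4 _ _ _ _
    _ < ε := by rw [dist_comm z y]; linarith

/-- `T t y` is `y` plus `t` times a convergent quotient. -/
theorem HasGenerator.tendsto {Y : Type*} [NormedAddCommGroup Y] [NormedSpace ℝ Y]
    {T : ℝ≥0 → Y →L[ℝ] Y} {y z : Y} (h : HasGenerator T y z) :
    Tendsto (fun t => T t y) (𝓝[>] 0) (𝓝 y) := by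
  have h0 : Tendsto (fun t : ℝ≥0 => (t : ℝ)) (𝓝[>] 0) (𝓝 0) :=
    tendsto_nhdsWithin_of_tendsto_nhds NNReal.continuous_coe.continuousAt
  have h1 := (h0.smul h).add_const y
  rw [zero_smul, zero_add] at h1
  refine h1.congr' ?_
  filter_upwards [self_mem_nhdsWithin] with t ht
  have : (t : ℝ) ≠ 0 := NNReal.coe_ne_zero.2 (ne_of_gt ht)
  rw [smul_inv_smul₀ this, sub_add_cancel]

end

/-! ### The multiplier in `t` and the Fourier form of the generator. -/

section

variable {d : ℕ} {μ ν : Measure (Euc d)} {b : Euc d}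

theorem norm_exp_I_mul_ofReal (y : ℝ) : ‖Complex.exp (Complex.I * y)‖ = 1 := by
  rw [mul_comm, Complex.norm_exp_ofReal_mul_I]

theorem integral_comp_add_eq_integral_fourierS (ρ : Measure (Euc d)) [IsProbabilityMeasure ρ]
    (f : 𝓢(Euc d, ℝ)) (z : Euc d) :
    ((∫ u, f (u + z) ∂ρ : ℝ) : ℂ) = (1 / (2 * Real.pi : ℂ) ^ d) *
      ∫ ξ, fourierS f ξ * Complex.exp (Complex.I * (inner ℝ z ξ : ℝ)) * charFun ρ ξ := by
  have hfm := (continuous_fourierS f).measurable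
  rw [← integral_complex_ofReal]
  simp only [ofReal_eq_integral_fourierS f]
  rw [integral_const_mul, integral_integral_swap]
  · congr 2 with ξ
    rw [charFun_apply, ← integral_const_mul]
    congr 1 with u
    rw [mul_assoc, ← Complex.exp_add, inner_add_left]
    congr 2
    push_cast; ring
  · have h1 : Integrable (fun p : Euc d × Euc d => (1 : ℂ) * fourierS f p.2)
        (ρ.prod volume) := (integrable_const 1).mul_prod (integrable_fourierS f)
    refine h1.mono ?_ (ae_of_all _ fun p => ?_)
    · simp only [Function.uncurry_def]; fun_prop
    · simp only [Function.uncurry_def]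
      rw [norm_mul, norm_exp_I_mul_ofReal]; simp

/-- The Fourier multiplier `ξ ↦ e^{i e^{-t} ⟨x, ξ⟩} φ(ξ) / φ(e^{-t} ξ)` of `P_t`. -/
noncomputable def multiplier (ν : Measure (Euc d)) (m x ξ : Euc d) (t : ℝ) : ℂ :=
  Complex.exp (Complex.I * (Real.exp (-t) * inner ℝ x ξ : ℝ)
    + (levyExp ν m ξ - levyExp ν m (Real.exp (-t) • ξ)))

theorem multiplier_zero (ν : Measure (Euc d)) (m x ξ : Euc d) :
    multiplier ν m x ξ 0 = Complex.exp (Complex.I * (inner ℝ x ξ : ℝ)) := by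
  simp [multiplier]

theorem hasDerivAt_multiplier (hK : Integrable (fun u => min ‖u‖ (‖u‖ ^ 2)) ν)
    (m x ξ : Euc d) (t : ℝ) :
    HasDerivAt (multiplier ν m x ξ) (multiplier ν m x ξ t *
      (levySymbol ν m (Real.exp (-t) • ξ)
        - Complex.I * (Real.exp (-t) * inner ℝ x ξ : ℝ))) t := by
  have h1 : HasDerivAt (fun t : ℝ => Real.exp (-t)) (-Real.exp (-t)) t := by
    simpa using (hasDerivAt_neg t).exp
  have h2 := ((h1.mul_const (inner ℝ x ξ)).ofReal_comp).const_mul Complex.I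
  have h3 := (hasDerivAt_levyExp_exp_neg_smul hK m ξ t).const_sub (levyExp ν m ξ)
  refine ((h2.add h3).cexp).congr_deriv ?_
  rw [multiplier]
  simp only [Pi.add_apply]
  congr 1
  push_cast; ring

/-- Mean value inequality on `[0, ∞)`. By `h1` the multiplier has modulus at most `1`, and `e^{-s} ≤
1` lets the symbol at `e^{-s}ξ` be bounded as at `ξ`. -/
theorem norm_multiplier_sub_le (hK : Integrable (fun u => min ‖u‖ (‖u‖ ^ 2)) ν)
    {m ξ : Euc d}
    (h1 : ∀ t : ℝ, 0 ≤ t →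
      ‖Complex.exp (levyExp ν m ξ - levyExp ν m (Real.exp (-t) • ξ))‖ ≤ 1)
    (x : Euc d) {t : ℝ} (ht : 0 ≤ t) :
    ‖multiplier ν m x ξ t - multiplier ν m x ξ 0‖
      ≤ ((‖m‖ + 2 * ∫ u, min ‖u‖ (‖u‖ ^ 2) ∂ν) * (‖ξ‖ + ‖ξ‖ ^ 2) + ‖x‖ * ‖ξ‖) * t := by
  have h0 : 0 ≤ ∫ u, min ‖u‖ (‖u‖ ^ 2) ∂ν := integral_nonneg fun u => by positivity
  have := (convex_Ici (0 : ℝ)).norm_image_sub_le_of_norm_hasDerivWithin_le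
    (f := multiplier ν m x ξ)
    (C := (‖m‖ + 2 * ∫ u, min ‖u‖ (‖u‖ ^ 2) ∂ν) * (‖ξ‖ + ‖ξ‖ ^ 2) + ‖x‖ * ‖ξ‖)
    (fun s _ => (hasDerivAt_multiplier hK m x ξ s).hasDerivWithinAt) (fun s hs => ?_)
    (mem_Ici.2 le_rfl) (mem_Ici.2 ht)
  · simpa [abs_of_nonneg ht] using this
  · have he : Real.exp (-s) ≤ 1 := Real.exp_le_one_iff.2 (by simpa using hs)
    have hξ : ‖Real.exp (-s) • ξ‖ ≤ ‖ξ‖ := by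
      rw [norm_smul, Real.norm_of_nonneg (Real.exp_pos _).le]
      exact mul_le_of_le_one_left (norm_nonneg _) he
    have h2 : ‖multiplier ν m x ξ s‖ ≤ 1 := by
      rw [multiplier, Complex.exp_add, norm_mul, norm_exp_I_mul_ofReal, one_mul]
      exact h1 s hs
    have h3 : ‖Complex.I * ((Real.exp (-s) * inner ℝ x ξ : ℝ) : ℂ)‖ ≤ ‖x‖ * ‖ξ‖ := by
      rw [norm_mul, Complex.norm_I, one_mul, Complex.norm_real, ← real_inner_smul_right]
      refine (norm_inner_le_norm x _).trans ?_
      gcongr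
    have h4 : ‖levySymbol ν m (Real.exp (-s) • ξ)‖
        ≤ (‖m‖ + 2 * ∫ u, min ‖u‖ (‖u‖ ^ 2) ∂ν) * (‖ξ‖ + ‖ξ‖ ^ 2) := by
      refine (norm_levySymbol_le hK m _).trans ?_
      generalize ∫ u, min ‖u‖ (‖u‖ ^ 2) ∂ν = J at h0 ⊢
      generalize Real.exp (-s) • ξ = η at hξ ⊢
      gcongr
    have h5 := (norm_sub_le (levySymbol ν m (Real.exp (-s) • ξ))
      (Complex.I * ((Real.exp (-s) * inner ℝ x ξ : ℝ) : ℂ))).trans (add_le_add h4 h3)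
    rw [norm_mul, ← one_mul ((‖m‖ + _) * _ + _)]
    exact mul_le_mul h2 h5 (norm_nonneg _) zero_le_one

/-- The bound factors into `min ‖u‖ ‖u‖²` and a polynomial in `‖ξ‖` times `|F f|`. It yields both
the absolute convergence of the jump integral and the exchange of `ν(du)` with `dξ`. -/
theorem integrable_prod_fourierS_mul [SFinite ν]
    (hK : Integrable (fun u => min ‖u‖ (‖u‖ ^ 2)) ν)
    (f : 𝓢(Euc d, ℝ)) (x : Euc d) :
    Integrable (fun p : Euc d × Euc d => fourierS f p.2
      * Complex.exp (Complex.I * (inner ℝ x p.2 : ℝ))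
      * (Complex.I * (inner ℝ p.2 p.1 : ℝ)
        * (Complex.exp (Complex.I * (inner ℝ p.2 p.1 : ℝ)) - 1))) (ν.prod volume) := by
  have hfm := (continuous_fourierS f).measurable
  have h1 := hK.mul_prod (((integrable_norm_pow_mul_norm_fourierS f 1).const_mul 2).add
    (integrable_norm_pow_mul_norm_fourierS f 2))
  refine h1.mono' (by fun_prop) (ae_of_all _ fun p => ?_)
  rw [norm_mul, norm_mul, norm_exp_I_mul_ofReal, mul_one]
  have h2 := norm_inner_mul_exp_sub_one_le p.2 p.1 1
  rw [one_mul, abs_one, one_mul] at h2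
  calc _ ≤ ‖fourierS f p.2‖ * ((2 * ‖p.2‖ + ‖p.2‖ ^ 2) * min ‖p.1‖ (‖p.1‖ ^ 2)) := by gcongr
    _ = _ := by simp only [Pi.add_apply]; ring

theorem inner_gradient_sub_eq_integral_fourierS (f : 𝓢(Euc d, ℝ)) (x u : Euc d) :
    ((inner ℝ (gradient f (x + u) - gradient f x) u : ℝ) : ℂ) = (1 / (2 * Real.pi : ℂ) ^ d) *
      ∫ ξ, fourierS f ξ * Complex.exp (Complex.I * (inner ℝ x ξ : ℝ))
      * (Complex.I * (inner ℝ ξ u : ℝ)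
        * (Complex.exp (Complex.I * (inner ℝ ξ u : ℝ)) - 1)) := by
  have hfm := (continuous_fourierS f).measurable
  have hi (y : Euc d) : Integrable (fun ξ => fourierS f ξ * (Complex.I * (inner ℝ u ξ : ℝ)
        * Complex.exp (Complex.I * (inner ℝ y ξ : ℝ)))) := by
    refine ((integrable_norm_pow_mul_norm_fourierS f 1).const_mul ‖u‖).mono' (by fun_prop)
      (ae_of_all _ fun ξ => ?_)
    have := abs_real_inner_le_norm u ξ
    rw [norm_mul, norm_mul, norm_exp_I_mul_ofReal]
    simp only [norm_mul, Complex.norm_I, one_mul, Complex.norm_real, Real.norm_eq_abs, mul_one,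
      pow_one]
    nlinarith [norm_nonneg (fourierS f ξ)]
  rw [inner_sub_left, Complex.ofReal_sub, inner_gradient_eq_integral_fourierS,
    inner_gradient_eq_integral_fourierS, ← mul_sub, ← integral_sub (hi _) (hi _)]
  congr 2 with ξ
  rw [inner_add_left, real_inner_comm ξ u, Complex.ofReal_add, mul_add, Complex.exp_add]
  ring

theorem integrable_inner_gradient_sub [SFinite ν]
    (hK : Integrable (fun u => min ‖u‖ (‖u‖ ^ 2)) ν)
    (f : 𝓢(Euc d, ℝ)) (x : Euc d) :
    Integrable (fun u => (inner ℝ (gradient f (x + u) - gradient f x) u : ℝ)) ν := by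
  have h1 := ((integrable_prod_fourierS_mul hK f x).integral_prod_left).const_mul
    (1 / (2 * Real.pi : ℂ) ^ d)
  simp only [← inner_gradient_sub_eq_integral_fourierS] at h1
  simpa using h1.re

/-- The factor multiplying `fourierS f ξ` is the derivative of `multiplier` at `t = 0`. -/
theorem steinOp_eq_integral_fourierS [SFinite ν]
    (hK : Integrable (fun u => min ‖u‖ (‖u‖ ^ 2)) ν)
    (f : 𝓢(Euc d, ℝ)) (m x : Euc d) :
    (steinOp m ν f x : ℂ) = (1 / (2 * Real.pi : ℂ) ^ d) *
      ∫ ξ, fourierS f ξ * (Complex.exp (Complex.I * (inner ℝ x ξ : ℝ)) *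
        (levySymbol ν m ξ - Complex.I * (inner ℝ x ξ : ℝ))) := by
  have hfm := (continuous_fourierS f).measurable
  have hP := integrable_prod_fourierS_mul hK f x
  have h1 : Integrable (fun ξ => fourierS f ξ * (Complex.I * (inner ℝ (m - x) ξ : ℝ)
        * Complex.exp (Complex.I * (inner ℝ x ξ : ℝ)))) := by
    refine ((integrable_norm_pow_mul_norm_fourierS f 1).const_mul ‖m - x‖).mono' (by fun_prop)
      (ae_of_all _ fun ξ => ?_)
    have := abs_real_inner_le_norm (m - x) ξ
    rw [norm_mul, norm_mul, norm_exp_I_mul_ofReal]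
    simp only [norm_mul, Complex.norm_I, one_mul, Complex.norm_real, Real.norm_eq_abs, mul_one,
      pow_one]
    nlinarith [norm_nonneg (fourierS f ξ)]
  rw [steinOp, Complex.ofReal_add, real_inner_comm, inner_gradient_eq_integral_fourierS,
    ← integral_complex_ofReal]
  simp only [inner_gradient_sub_eq_integral_fourierS]
  rw [integral_const_mul, integral_integral_swap hP, ← mul_add,
    ← integral_add h1 hP.integral_prod_right]
  congr 2 with ξ
  dsimp only
  rw [integral_const_mul, levySymbol, inner_sub_left, Complex.ofReal_sub]
  ring

end

/-! ### Difference quotients and their limits. -/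

section

variable {d : ℕ} {μ ν : Measure (Euc d)} {b : Euc d}

theorem IsSelfDecomposable.exists_isProbabilityMeasure_charFun [IsProbabilityMeasure μ]
    (hsd : IsSelfDecomposable μ) (h0 : ∀ ξ, charFun μ ξ ≠ 0) (t : ℝ≥0) :
    ∃ ρ : Measure (Euc d), IsProbabilityMeasure ρ ∧
      ∀ ξ, charFun ρ ξ = charFun μ ξ / charFun μ (Real.exp (-(t : ℝ)) • ξ) := by
  -- Self-decomposability only covers `γ < 1`; at `t = 0` the quotient is constantly `1`, the
  -- transform of the Dirac mass.
  rcases eq_or_ne t 0 with rfl | ht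
  · refine ⟨Measure.dirac 0, inferInstance, fun ξ => ?_⟩
    simp [charFun_dirac, h0]
  · obtain ⟨ρ, hρ, hρ'⟩ := hsd (Real.exp (-(t : ℝ))) (Real.exp_pos _)
      (Real.exp_lt_one_iff.2 (by simpa using pos_of_ne_zero ht))
    exact ⟨ρ, hρ, fun ξ => by rw [hρ' ξ, mul_div_cancel_left₀ _ (h0 _)]⟩

/-- The difference quotient `(P_t f(x) - f(x)) / t`. -/
noncomputable def diffQuot (ρ : ℝ≥0 → Measure (Euc d)) (f : 𝓢(Euc d, ℝ)) (t : ℝ≥0)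
    (x : Euc d) : ℝ :=
  (t : ℝ)⁻¹ * ((∫ u, f (u + Real.exp (-(t : ℝ)) • x) ∂(ρ t)) - f x)

theorem ofReal_diffQuot {ρ : ℝ≥0 → Measure (Euc d)} [∀ t, IsProbabilityMeasure (ρ t)] {m : Euc d}
    (hρ : ∀ (t : ℝ≥0) ξ, charFun (ρ t) ξ
      = Complex.exp (levyExp ν m ξ - levyExp ν m (Real.exp (-(t : ℝ)) • ξ)))
    (f : 𝓢(Euc d, ℝ)) (t : ℝ≥0) (x : Euc d) :
    (diffQuot ρ f t x : ℂ) = (1 / (2 * Real.pi : ℂ) ^ d) *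
      ∫ ξ, fourierS f ξ * ((t : ℝ)⁻¹ • (multiplier ν m x ξ t - multiplier ν m x ξ 0)) := by
  have hfm := (continuous_fourierS f).measurable
  have hm (t : ℝ≥0) (ξ : Euc d) : multiplier ν m x ξ t = Complex.exp (Complex.I *
      (inner ℝ (Real.exp (-(t : ℝ)) • x) ξ : ℝ)) * charFun (ρ t) ξ := by
    rw [multiplier, Complex.exp_add, hρ, real_inner_smul_left]
  have hi (t : ℝ≥0) : Integrable (fun ξ => fourierS f ξ * multiplier ν m x ξ t) := by
    have := measurable_charFun (μ := ρ t)
    simp only [hm]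
    refine (integrable_fourierS f).mono (by fun_prop) (ae_of_all _ fun ξ => ?_)
    rw [norm_mul, norm_mul, norm_exp_I_mul_ofReal, one_mul]
    exact mul_le_of_le_one_right (norm_nonneg _) (norm_charFun_le_one ξ)
  have hi0 := hi 0
  rw [NNReal.coe_zero] at hi0
  rw [diffQuot, Complex.ofReal_mul, Complex.ofReal_sub, integral_comp_add_eq_integral_fourierS,
    ofReal_eq_integral_fourierS f x]
  simp only [mul_assoc (fourierS f _), ← hm, ← multiplier_zero ν m x]
  rw [← mul_sub, ← integral_sub (hi t) hi0, mul_left_comm, ← integral_const_mul]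
  congr 2 with ξ
  rw [Complex.real_smul]
  ring

theorem norm_smul_multiplier_sub_le {ρ : ℝ≥0 → Measure (Euc d)}
    [∀ t, IsProbabilityMeasure (ρ t)] {m : Euc d}
    (hρ : ∀ (t : ℝ≥0) ξ, charFun (ρ t) ξ
      = Complex.exp (levyExp ν m ξ - levyExp ν m (Real.exp (-(t : ℝ)) • ξ)))
    (hK : Integrable (fun u => min ‖u‖ (‖u‖ ^ 2)) ν) (x ξ : Euc d) {t : ℝ≥0} (ht : 0 < t) :
    ‖(t : ℝ)⁻¹ • (multiplier ν m x ξ t - multiplier ν m x ξ 0)‖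
      ≤ (‖m‖ + 2 * ∫ u, min ‖u‖ (‖u‖ ^ 2) ∂ν) * (‖ξ‖ + ‖ξ‖ ^ 2) + ‖x‖ * ‖ξ‖ := by
  have ht' : (0 : ℝ) < t := ht
  have := norm_multiplier_sub_le hK (m := m) (ξ := ξ) (fun s hs => by
    lift s to ℝ≥0 using hs
    rw [← hρ]
    exact norm_charFun_le_one ξ) x ht'.le
  rw [norm_smul, norm_inv, Real.norm_of_nonneg ht'.le, inv_mul_le_iff₀ ht', mul_comm (t : ℝ)]
  exact this

/-- The bound is uniform in `t` and affine in `‖x‖`, hence `μ`-integrable when `μ` has a first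
moment; this upgrades pointwise convergence to `L¹(μ)`. -/
theorem exists_abs_diffQuot_le {ρ : ℝ≥0 → Measure (Euc d)} [∀ t, IsProbabilityMeasure (ρ t)]
    {m : Euc d} (hρ : ∀ (t : ℝ≥0) ξ, charFun (ρ t) ξ
      = Complex.exp (levyExp ν m ξ - levyExp ν m (Real.exp (-(t : ℝ)) • ξ)))
    (hK : Integrable (fun u => min ‖u‖ (‖u‖ ^ 2)) ν) (f : 𝓢(Euc d, ℝ)) :
    ∃ A B : ℝ, ∀ t : ℝ≥0, 0 < t → ∀ x, |diffQuot ρ f t x| ≤ A + B * ‖x‖ := by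
  have h1 := integrable_norm_pow_mul_norm_fourierS f 1
  have h2 := integrable_norm_pow_mul_norm_fourierS f 2
  set C := ‖m‖ + 2 * ∫ u, min ‖u‖ (‖u‖ ^ 2) ∂ν with hC
  set M₁ := ∫ ξ, ‖ξ‖ ^ 1 * ‖fourierS f ξ‖
  set M₂ := ∫ ξ, ‖ξ‖ ^ 2 * ‖fourierS f ξ‖
  set c := ‖1 / (2 * Real.pi : ℂ) ^ d‖
  refine ⟨c * (C * (M₁ + M₂)), c * M₁, fun t ht x => ?_⟩
  have h3 : ‖∫ ξ, fourierS f ξ * ((t : ℝ)⁻¹ • (multiplier ν m x ξ t - multiplier ν m x ξ 0))‖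
      ≤ ∫ ξ, (C * (‖ξ‖ ^ 1 * ‖fourierS f ξ‖ + ‖ξ‖ ^ 2 * ‖fourierS f ξ‖)
        + ‖x‖ * (‖ξ‖ ^ 1 * ‖fourierS f ξ‖)) := by
    refine norm_integral_le_of_norm_le (((h1.add h2).const_mul C).add (h1.const_mul ‖x‖))
      (ae_of_all _ fun ξ => ?_)
    rw [norm_mul]
    refine (mul_le_mul_of_nonneg_left (norm_smul_multiplier_sub_le hρ hK x ξ ht)
      (norm_nonneg _)).trans_eq ?_
    rw [← hC]
    ring
  have h12 : Integrable fun ξ : Euc d =>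
      C * (‖ξ‖ ^ 1 * ‖fourierS f ξ‖ + ‖ξ‖ ^ 2 * ‖fourierS f ξ‖) := (h1.add h2).const_mul C
  rw [integral_add h12 (h1.const_mul ‖x‖), integral_const_mul,
    integral_add h1 h2, integral_const_mul] at h3
  rw [← Real.norm_eq_abs, ← Complex.norm_real, ofReal_diffQuot hρ, norm_mul]
  refine (mul_le_mul_of_nonneg_left h3 (norm_nonneg _)).trans_eq ?_
  ring

theorem tendsto_coe_nhdsGT_zero :
    Tendsto (fun t : ℝ≥0 => (t : ℝ)) (𝓝[>] 0) (𝓝[>] 0) := by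
  refine tendsto_nhdsWithin_iff.2 ⟨tendsto_nhdsWithin_of_tendsto_nhds
    NNReal.continuous_coe.continuousAt, ?_⟩
  filter_upwards [self_mem_nhdsWithin] with t ht
  exact NNReal.coe_pos.2 ht

theorem tendsto_diffQuot [SFinite ν] {ρ : ℝ≥0 → Measure (Euc d)}
    [∀ t, IsProbabilityMeasure (ρ t)] {m : Euc d} (hρ : ∀ (t : ℝ≥0) ξ, charFun (ρ t) ξ
      = Complex.exp (levyExp ν m ξ - levyExp ν m (Real.exp (-(t : ℝ)) • ξ)))
    (hK : Integrable (fun u => min ‖u‖ (‖u‖ ^ 2)) ν) (f : 𝓢(Euc d, ℝ)) (x : Euc d) :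
    Tendsto (fun t => diffQuot ρ f t x) (𝓝[>] 0) (𝓝 (steinOp m ν f x)) := by
  have hfm := (continuous_fourierS f).measurable
  suffices hc : Tendsto (fun t => (diffQuot ρ f t x : ℂ)) (𝓝[>] 0)
      (𝓝 (steinOp m ν f x : ℂ)) by
    simpa [Function.comp_def] using (Complex.continuous_re.tendsto _).comp hc
  simp only [ofReal_diffQuot hρ, steinOp_eq_integral_fourierS hK]
  refine Tendsto.const_mul _ ?_
  have h1 := integrable_norm_pow_mul_norm_fourierS f 1
  have h2 := integrable_norm_pow_mul_norm_fourierS f 2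
  set C := ‖m‖ + 2 * ∫ u, min ‖u‖ (‖u‖ ^ 2) ∂ν with hC
  refine tendsto_integral_filter_of_dominated_convergence
    (fun ξ => C * (‖ξ‖ ^ 1 * ‖fourierS f ξ‖ + ‖ξ‖ ^ 2 * ‖fourierS f ξ‖)
        + ‖x‖ * (‖ξ‖ ^ 1 * ‖fourierS f ξ‖)) (Eventually.of_forall fun t => ?_) ?_
    (((h1.add h2).const_mul C).add (h1.const_mul ‖x‖)) (ae_of_all _ fun ξ => ?_)
  · have hm (t : ℝ≥0) : Measurable fun ξ => multiplier ν m x ξ t := by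
      have := measurable_charFun (μ := ρ t)
      simp only [multiplier, Complex.exp_add (Complex.I * _), ← hρ]
      fun_prop
    have := hm t
    have h0 := hm 0
    rw [NNReal.coe_zero] at h0
    fun_prop
  · filter_upwards [self_mem_nhdsWithin] with t ht
    refine ae_of_all _ fun ξ => ?_
    rw [norm_mul]
    refine (mul_le_mul_of_nonneg_left (norm_smul_multiplier_sub_le hρ hK x ξ ht)
      (norm_nonneg _)).trans_eq ?_
    rw [← hC]
    ring
  · refine Tendsto.const_mul _ ?_
    have h3 := (hasDerivAt_multiplier hK m x ξ 0).tendsto_slope_zero_right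
    rw [multiplier_zero] at h3
    simpa [Function.comp_def, multiplier_zero] using h3.comp tendsto_coe_nhdsGT_zero

theorem measurable_diffQuot {ρ : ℝ≥0 → Measure (Euc d)} [∀ t, IsProbabilityMeasure (ρ t)]
    (f : 𝓢(Euc d, ℝ)) (t : ℝ≥0) : Measurable (diffQuot ρ f t) := by
  have h1 : Measurable fun x => ∫ u, f (u + Real.exp (-(t : ℝ)) • x) ∂(ρ t) := by
    have : StronglyMeasurable (Function.uncurry fun x u : Euc d =>
        f (u + Real.exp (-(t : ℝ)) • x)) := by
      simp only [Function.uncurry_def]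
      exact Continuous.stronglyMeasurable (by fun_prop)
    exact this.integral_prod_right.measurable
  unfold diffQuot
  fun_prop

/-- Measurability and the affine bound are inherited from the difference quotients in the limit. -/
theorem integrable_steinOp [SFinite ν] [IsProbabilityMeasure μ] {ρ : ℝ≥0 → Measure (Euc d)}
    [∀ t, IsProbabilityMeasure (ρ t)] {m : Euc d} (hρ : ∀ (t : ℝ≥0) ξ, charFun (ρ t) ξ
      = Complex.exp (levyExp ν m ξ - levyExp ν m (Real.exp (-(t : ℝ)) • ξ)))
    (hK : Integrable (fun u => min ‖u‖ (‖u‖ ^ 2)) ν) (hμ : Integrable (fun x => x) μ)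
    (f : 𝓢(Euc d, ℝ)) : Integrable (steinOp m ν f) μ := by
  obtain ⟨A, B, hAB⟩ := exists_abs_diffQuot_le hρ hK f
  refine ((integrable_const A).add (hμ.norm.const_mul B)).mono' ?_ (ae_of_all _ fun x => ?_)
  · exact aestronglyMeasurable_of_tendsto_ae (𝓝[>] (0 : ℝ≥0))
      (fun t => (measurable_diffQuot f t).aestronglyMeasurable)
      (ae_of_all _ fun x => tendsto_diffQuot hρ hK f x)
  · refine le_of_tendsto (tendsto_diffQuot hρ hK f x).norm ?_
    filter_upwards [self_mem_nhdsWithin] with t ht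
    exact hAB t ht x

theorem tendsto_integral_abs_diffQuot_sub [SFinite ν] [IsProbabilityMeasure μ]
    {ρ : ℝ≥0 → Measure (Euc d)} [∀ t, IsProbabilityMeasure (ρ t)] {m : Euc d}
    (hρ : ∀ (t : ℝ≥0) ξ, charFun (ρ t) ξ
      = Complex.exp (levyExp ν m ξ - levyExp ν m (Real.exp (-(t : ℝ)) • ξ)))
    (hK : Integrable (fun u => min ‖u‖ (‖u‖ ^ 2)) ν) (hμ : Integrable (fun x => x) μ)
    (f : 𝓢(Euc d, ℝ)) :
    Tendsto (fun t => ∫ x, ‖diffQuot ρ f t x - steinOp m ν f x‖ ∂μ) (𝓝[>] 0) (𝓝 0) := by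
  obtain ⟨A, B, hAB⟩ := exists_abs_diffQuot_le hρ hK f
  have hS := integrable_steinOp hρ hK hμ f
  rw [← integral_zero (Euc d) ℝ (μ := μ)]
  refine tendsto_integral_filter_of_dominated_convergence
    (fun x => (A + B * ‖x‖) + ‖steinOp m ν f x‖) (Eventually.of_forall fun t =>
      ((measurable_diffQuot f t).aestronglyMeasurable.sub hS.aestronglyMeasurable).norm) ?_
    (((integrable_const A).add (hμ.norm.const_mul B)).add hS.norm) (ae_of_all _ fun x => ?_)
  · filter_upwards [self_mem_nhdsWithin] with t ht
    refine ae_of_all _ fun x => ?_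
    rw [norm_norm]
    exact (norm_sub_le _ _).trans (add_le_add_left (hAB t ht x) _)
  · exact tendsto_iff_norm_sub_tendsto_zero.1 (tendsto_diffQuot hρ hK f x)

end

end SelfDecomp

/-! ### Assembly of the semigroup and its generator. -/

theorem mainTheorem8 {d : ℕ} (hd : 1 ≤ d) {Ω : Type*} [MeasurableSpace Ω] (P : Measure Ω)
    [IsProbabilityMeasure P] (X : Ω → SelfDecomp.Euc d) (μ : Measure (SelfDecomp.Euc d))
    [IsProbabilityMeasure μ] (hX : HasLaw X μ P)
    (hnd : SelfDecomp.IsNonDegenerate μ)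
    (hsd : SelfDecomp.IsSelfDecomposable μ)
    (b : SelfDecomp.Euc d) (ν : Measure (SelfDecomp.Euc d))
    -- no Gaussian component, Lévy measure `ν`
    (hν : SelfDecomp.IsInfDivTriplet μ b 0 ν)
    (hmom : Integrable X P)
    (hk : SelfDecomp.LocallyBoundedRadial ν) :
    ∃ (m : ℝ≥0 → Measure (SelfDecomp.Euc d))
      (T : ℝ≥0 → Lp ℝ 1 μ →L[ℝ] Lp ℝ 1 μ),
      -- the probability measures `μ_t`
      (∀ t, IsProbabilityMeasure (m t) ∧
        ∀ ξ, charFun (m t) ξ = charFun μ ξ / charFun μ (Real.exp (-(t : ℝ)) • ξ)) ∧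
      -- the two formulas for `P_t f` agree on the Schwartz space
      (∀ t (f : 𝓢(SelfDecomp.Euc d, ℝ)) x, SelfDecomp.semigroupS μ t f x =
        ((∫ u, f (u + Real.exp (-(t : ℝ)) • x) ∂(m t) : ℝ) : ℂ)) ∧
      -- `T t` is the operator `P_t` on all of `L¹(μ)`
      (∀ (t : ℝ≥0) (f : SelfDecomp.Euc d → ℝ) (hf : Integrable f μ),
        (∀ᵐ x ∂μ, Integrable (fun u => f (u + Real.exp (-(t : ℝ)) • x)) (m t)) ∧
        T t (hf.toL1 f) =ᵐ[μ] fun x => ∫ u, f (u + Real.exp (-(t : ℝ)) • x) ∂(m t)) ∧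
      SelfDecomp.IsC0Semigroup T ∧
      -- `μ` is invariant
      (∀ t (g : Lp ℝ 1 μ), ∫ x, T t g x ∂μ = ∫ x, g x ∂μ) ∧
      -- the generator on the Schwartz space, in `L¹(μ)` and pointwise
      (∀ f : 𝓢(SelfDecomp.Euc d, ℝ),
        (∀ x, Integrable (fun u => (inner ℝ (gradient f (x + u) - gradient f x) u : ℝ)) ν) ∧
        (∃ h : Integrable (SelfDecomp.steinOp (∫ ω, X ω ∂P) ν f) μ,
          SelfDecomp.HasGenerator T (f.toLp 1 μ) (h.toL1 _)) ∧
        (∀ x, Tendsto (fun t : ℝ≥0 =>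
            (t : ℝ)⁻¹ * ((∫ u, f (u + Real.exp (-(t : ℝ)) • x) ∂(m t)) - f x))
          (𝓝[>] 0) (𝓝 (SelfDecomp.steinOp (∫ ω, X ω ∂P) ν f x)))) := by
  have hid : Integrable (fun x => x) μ := by
    have h1 := hX.map_eq ▸ (integrable_map_measure (f := X) (g := fun x => x) (μ := P)
      (by fun_prop) hX.aemeasurable).2 hmom
    exact h1
  have hK := hν.integrable_min_norm_sq hid
  have := hν.levy.sFinite
  have hφ := hν.charFun_eq_exp_levyExp hid
  have hmean : ∫ ω, X ω ∂P = ∫ x, x ∂μ := hX.integral_eq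
  rw [hmean]
  have h0 (ξ) : charFun μ ξ ≠ 0 := by rw [hφ]; exact Complex.exp_ne_zero _
  choose ρ hρP hρ using hsd.exists_isProbabilityMeasure_charFun h0
  have hρ' (t : ℝ≥0) (ξ) : charFun (ρ t) ξ = Complex.exp (SelfDecomp.levyExp ν (∫ x, x ∂μ) ξ
      - SelfDecomp.levyExp ν (∫ x, x ∂μ) (Real.exp (-(t : ℝ)) • ξ)) := by
    rw [hρ, hφ, hφ, Complex.exp_sub]
  have hμρ (t : ℝ≥0) : MeasurePreserving
      (fun p : SelfDecomp.Euc d × SelfDecomp.Euc d => p.2 + Real.exp (-(t : ℝ)) • p.1)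
      (μ.prod (ρ t)) μ :=
    SelfDecomp.measurePreserving_add_smul fun ξ => by rw [hρ, mul_div_cancel₀ _ (h0 _)]
  have hρρ (s t : ℝ≥0) : MeasurePreserving
      (fun p : SelfDecomp.Euc d × SelfDecomp.Euc d => p.2 + Real.exp (-(t : ℝ)) • p.1)
      ((ρ s).prod (ρ t)) (ρ (s + t)) :=
    SelfDecomp.measurePreserving_add_smul fun ξ => by
      -- The factor `φ(e^{-t}ξ)` telescopes between the transform of `ρ s` at `e^{-t}ξ` and that of
      -- `ρ t` at `ξ`.
      rw [hρ, hρ, hρ, smul_smul, ← Real.exp_add, ← neg_add, ← NNReal.coe_add]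
      have := h0 (Real.exp (-(t : ℝ)) • ξ)
      have := h0 (Real.exp (-((s + t : ℝ≥0) : ℝ)) • ξ)
      field_simp
  let T : ℝ≥0 → Lp ℝ 1 μ →L[ℝ] Lp ℝ 1 μ := fun t => SelfDecomp.averageL1 (hμρ t)
  have hTf (t : ℝ≥0) {f : SelfDecomp.Euc d → ℝ} (hf : Integrable f μ) :
      T t (hf.toL1 f) =ᵐ[μ] fun x => ∫ u, f (u + Real.exp (-(t : ℝ)) • x) ∂(ρ t) :=
    SelfDecomp.averageL1_toL1 (hμρ t) hf
  have hgen (f : 𝓢(SelfDecomp.Euc d, ℝ)) : SelfDecomp.HasGenerator T (f.toLp 1 μ)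
      ((SelfDecomp.integrable_steinOp hρ' hK hid f).toL1 _) := by
    have hfL : f.toLp 1 μ = (f.integrable (μ := μ)).toL1 f :=
      Lp.ext ((f.coeFn_toLp 1 μ).trans (Integrable.coeFn_toL1 _).symm)
    rw [SelfDecomp.HasGenerator, tendsto_iff_norm_sub_tendsto_zero]
    refine (SelfDecomp.tendsto_integral_abs_diffQuot_sub hρ' hK hid f).congr fun t => ?_
    rw [L1.norm_eq_integral_norm]
    refine integral_congr_ae ?_
    have hfi := f.integrable (μ := μ)
    filter_upwards [Lp.coeFn_sub ((t : ℝ)⁻¹ • (T t (f.toLp 1 μ) - f.toLp 1 μ))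
        ((SelfDecomp.integrable_steinOp hρ' hK hid f).toL1 _),
      Lp.coeFn_smul (t : ℝ)⁻¹ (T t (f.toLp 1 μ) - f.toLp 1 μ),
      Lp.coeFn_sub (T t (f.toLp 1 μ)) (f.toLp 1 μ), f.coeFn_toLp 1 μ, hTf t hfi,
      (SelfDecomp.integrable_steinOp hρ' hK hid f).coeFn_toL1] with x h1 h2 h3 h4 h5 h6
    rw [← hfL] at h5
    rw [h1, Pi.sub_apply, h2, Pi.smul_apply, h3, Pi.sub_apply, h4, h5, h6, smul_eq_mul,
      SelfDecomp.diffQuot]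
  refine ⟨ρ, T, fun t => ⟨hρP t, hρ t⟩, fun t f x => ?_, fun t f hf =>
    ⟨SelfDecomp.ae_integrable_average (hμρ t) hf, hTf t hf⟩, ⟨?_, fun s t => ?_, fun y => ?_⟩,
    fun t g => ?_, fun f => ⟨SelfDecomp.integrable_inner_gradient_sub hK f,
      ⟨SelfDecomp.integrable_steinOp hρ' hK hid f, hgen f⟩,
      SelfDecomp.tendsto_diffQuot hρ' hK f⟩⟩
  · rw [SelfDecomp.integral_comp_add_eq_integral_fourierS, SelfDecomp.semigroupS]
    simp only [hρ, real_inner_smul_left]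
  · have hdirac : ρ 0 = Measure.dirac 0 := by
      refine Measure.ext_of_charFun ?_
      ext ξ
      simp [hρ, h0]
    ext1 g
    refine Lp.ext ?_
    filter_upwards [SelfDecomp.averageL1_coeFn (hμρ 0) g] with x hx
    refine hx.trans ?_
    rw [hdirac, integral_dirac]
    simp
  · exact SelfDecomp.averageL1_comp (hμρ (s + t)) (hμρ s) (hμρ t) (hρρ s t) (by
      rw [← Real.exp_add]; congr 1; push_cast; ring)
  -- Strong continuity: on Schwartz functions it follows from differentiability at `0`, and
  -- contractivity extends it by density.
  · refine SelfDecomp.tendsto_of_dense_of_norm_le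
      (fun t => SelfDecomp.norm_averageL1_le (hμρ t))
      (SchwartzMap.denseRange_toLpCLM (F := ℝ) (μ := μ) ENNReal.one_ne_top) ?_ y
    rintro _ ⟨f, rfl⟩
    exact (hgen f).tendsto
  · rw [integral_congr_ae (SelfDecomp.averageL1_coeFn (hμρ t) g)]
    exact SelfDecomp.integral_average (hμρ t) (L1.integrable_coeFn g)
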